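/- For $m\ge 1$ let $f_m:=\prod_{i\ge 1}(1-q^{mi})$, and for $k\ge 0$ define integers $d_k(n)$ $(n\ge 0)$ by $$\sum_{n=0}^\infty d_k(n)q^n=\frac{f_2^k}{f_1^{3k+1}}.$$ Then for all integers $n\ge 0$ and $j\ge 0$, \begin{align*} d_{4j+3}(4n+2)&\equiv 0 \pmod{2},\\ d_{4j+3}(4n+3)&\equiv 0 \pmod{4},\\ d_{8j+7}(4n+2)&\equiv 0 \pmod{4},\\ d_{8j+7}(8n+5)&\equiv 0 \pmod{4},\\ d_{16j+7}(16n+9)&\equiv 0 \pmod{4},\\ d_{8j+7}(4n+3)&\equiv 0 \pmod{8},\\ d_{32j+7}(8n+4)&\equiv 0 \pmod{8},\\ d_{9j+8}(9n+3)&\equiv 0 \pmod{9},\\ d_{27j+2}(9n+8)&\equiv 0 \pmod{27},\\ d_{243j+2}(27n+8)&\equiv 0 \pmod{243}. \end{align*} -/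

import Mathlib

namespace ElongatedDiamond

open PowerSeries
open scoped PowerSeries.WithPiTopology

/-- `f_m = (q^m; q^m)_∞ = ∏_{j ≥ 0} (1 - q^{m (j+1)})` as a formal power series in `q = X`
with integer coefficients; the infinite product is the limit of its finite subproducts for
coefficientwise convergence. It is used for `m ≥ 1`, where the product converges
(see `multipliable_f`). -/
noncomputable def f (m : ℕ) : ℤ⟦X⟧ :=
  ∏' j : ℕ, (1 - (X : ℤ⟦X⟧) ^ (m * (j + 1)))

theorem multipliable_f {m : ℕ} (hm : 0 < m) :
    Multipliable fun j : ℕ => 1 - (X : ℤ⟦X⟧) ^ (m * (j + 1)) := by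
  simp_rw [sub_eq_add_neg]
  apply PowerSeries.WithPiTopology.multipliable_one_add_of_tendsto_order_atTop_nhds_top
  refine ENat.tendsto_nhds_top_iff_natCast_lt.mpr
    (fun n => Filter.eventually_atTop.mpr ⟨n, fun j hj => ?_⟩)
  rw [order_neg, order_X_pow]
  norm_cast
  nlinarith

theorem constantCoeff_f {m : ℕ} (hm : 0 < m) : constantCoeff (f m) = 1 := by
  rw [f, (multipliable_f hm).map_tprod _ (WithPiTopology.continuous_constantCoeff ℤ)]
  have h : ∀ j : ℕ, m * (j + 1) ≠ 0 := fun j => by positivity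
  simp [hm.ne']

/-- The quotient `f_2 ^ k / f_1 ^ (3 k + 1)` of formal power series; `f_1` is invertible as its
constant term is `1`, and `invOfUnit (f 1) 1` is its inverse. -/
noncomputable def genFun (k : ℕ) : ℤ⟦X⟧ :=
  f 2 ^ k * (invOfUnit (f 1) 1) ^ (3 * k + 1)

/-- `d k n` is `d_k(n)`, the coefficient of `q^n` in `f_2 ^ k / f_1 ^ (3 k + 1)`. -/
noncomputable def d (k n : ℕ) : ℤ := coeff n (genFun k)

theorem f_one_mul_inv : f 1 * invOfUnit (f 1) 1 = 1 :=
  mul_invOfUnit _ _ (by rw [constantCoeff_f one_pos, Units.val_one])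

/-- The defining generating function identity, with the denominator cleared. -/
theorem mk_d_mul (k : ℕ) : PowerSeries.mk (d k) * f 1 ^ (3 * k + 1) = f 2 ^ k := by
  have h : PowerSeries.mk (d k) = genFun k := by
    ext n
    simp [d]
  rw [h, genFun, mul_assoc, ← mul_pow, mul_comm (invOfUnit _ _), f_one_mul_inv, one_pow, mul_one]

end ElongatedDiamond

/-! Write φ(-q) = f_1²/f_2 and ψ(q) = f_2²/f_1. The Jacobi triple product (`hasSum_thetaTerm`) turns
such quotients into theta series, and sorting exponents by residue gives their 3- and 4-dissections.
The second tool is F(q)^{p^{k+1}} ≡ F(q^p)^{p^k} mod p^{k+1} (`red_pow_prime_pow`): high powers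
become series in q^p, which factor out of the extraction of an arithmetic progression
(`sec_mul_expand`).

Powers of 2: the generating function is φ(-q)^{-k} f_1^{-(k+1)}. As φ(-q) ≡ 1 mod 2, its fourth
power is 1 mod 8, so for k = 4i+3 the series is φ(-q) f_1^{-4(i+1)} mod 8. Here f_1^{-4} mod 4 and
f_1^{-8} mod 8 are powers of φ(-q²) times series in q^4, and the dissection φ(-q) = φ(q^4) -
2qψ(q^8) shows which residue classes carry extra factors 2.

Powers of 3: put G = f_2/f_1³. The series is φ(-q) G^{9(j+1)} for k = 9j+8 and ψ f_1^{-6} G^k for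
index k+2, and the powers of G that occur are congruent to series in q³. The carrying facts are f_1³
= P(q³) - 3q f_9³ and P³ - 27q f_3^9 = f_1^{12}/f_3³ (`f_one_cube_dissection`,
`cubeNorm_mul_cubeOne`), which dissect 1/f_1³. For the last two congruences, the first section
contributes a factor 3 (`sec_three_two_base`), the second a factor 9 (`sec_secQuot`), and the third
another 9 through a cancellation 16 + 2 = 18 (`red_nine_sec_secQuotTwo`). -/

open Filter PowerSeries Finset
open scoped PowerSeries.WithPiTopology

/-! ### Splitting sums and products into residue classes. -/

section Residues

variable {M : Type*} [CommMonoid M] [TopologicalSpace M] [ContinuousMul M]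

theorem hasProd_int_of_residues {h : ℤ → M} {n : ℕ} (hn : 0 < n) {P : ℕ → M}
    (H : ∀ r ∈ range n, HasProd (fun k : ℤ => h (n * k + r)) (P r)) :
    HasProd h (∏ r ∈ range n, P r) := by
  classical
  have hn' : (0 : ℤ) < n := by exact_mod_cast hn
  have key : ∀ r ∈ range n,
      HasProd (fun m : ℤ => if m % n = (r : ℤ) then h m else 1) (P r) := by
    intro r hr
    have hr' : (r : ℤ) < n := by exact_mod_cast Finset.mem_range.1 hr
    have inj : Function.Injective (fun k : ℤ => n * k + r : ℤ → ℤ) := by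
      intro x y hxy
      simpa [hn.ne'] using hxy
    refine (inj.hasProd_iff ?_).1 ?_
    · intro m hm
      rw [if_neg]
      intro hmr
      exact hm ⟨m / n, by simpa [hmr] using Int.mul_ediv_add_emod m n⟩
    · convert H r hr using 1
      funext k
      have : (n * k + r : ℤ) % n = r := by
        rw [Int.mul_add_emod_self_left]
        exact Int.emod_eq_of_lt (by positivity) hr'
      simp [this]
  refine (hasProd_prod key).congr_fun ?_
  intro m
  have h0 := Int.emod_nonneg m hn'.ne'
  have h1 := Int.emod_lt_of_pos m hn'
  rw [Finset.prod_eq_single (m % n).toNat]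
  · simp [h0]
  · intro b _ hb
    rw [if_neg]
    omega
  · intro hb
    exact absurd (Finset.mem_range.2 (by omega)) hb

theorem hasProd_nat_of_residues {h : ℕ → M} {n : ℕ} (hn : 0 < n) {P : ℕ → M}
    (H : ∀ r ∈ range n, HasProd (fun k : ℕ => h (n * k + r)) (P r)) :
    HasProd h (∏ r ∈ range n, P r) := by
  classical
  have key : ∀ r ∈ range n,
      HasProd (fun m : ℕ => if m % n = r then h m else 1) (P r) := by
    intro r hr
    have inj : Function.Injective (fun k : ℕ => n * k + r : ℕ → ℕ) := by
      intro x y hxy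
      simpa [hn.ne'] using hxy
    refine (inj.hasProd_iff ?_).1 ?_
    · intro m hm
      rw [if_neg]
      intro hmr
      exact hm ⟨m / n, by simpa [hmr] using Nat.div_add_mod m n⟩
    · convert H r hr using 1
      funext k
      have : (n * k + r) % n = r := by
        rw [Nat.mul_add_mod]
        exact Nat.mod_eq_of_lt (Finset.mem_range.1 hr)
      simp [this]
  refine (hasProd_prod key).congr_fun ?_
  intro m
  rw [Finset.prod_eq_single (m % n)]
  · simp
  · intro b _ hb
    rw [if_neg (Ne.symm hb)]
  · intro hb
    exact absurd (Finset.mem_range.2 (Nat.mod_lt _ hn)) hb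

end Residues

theorem hasSum_int_of_residues {M : Type*} [AddCommMonoid M] [TopologicalSpace M] [ContinuousAdd M]
    {h : ℤ → M} {n : ℕ} (hn : 0 < n) {P : ℕ → M}
    (H : ∀ r ∈ range n, HasSum (fun k : ℤ => h (n * k + r)) (P r)) :
    HasSum h (∑ r ∈ range n, P r) :=
  hasProd_int_of_residues (M := Multiplicative M) hn H

/-! ### Signed q-products. -/

namespace ElongatedDiamond

/-- `∏_{k ≥ 0} (1 - ε q^{a k + b})` for a sign `ε`. -/
noncomputable def qProd (ε : ℤˣ) (a b : ℕ) : ℤ⟦X⟧ :=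
  ∏' k : ℕ, (1 - ((ε : ℤ) : ℤ⟦X⟧) * X ^ (a * k + b))

theorem multipliable_one_add_mul_X_pow {R : Type*} [CommRing R] [TopologicalSpace R]
    (c : ℕ → R) {a : ℕ} (b : ℕ) (ha : 0 < a) :
    Multipliable fun k : ℕ => 1 + C (c k) * (X : R⟦X⟧) ^ (a * k + b) := by
  apply PowerSeries.WithPiTopology.multipliable_one_add_of_tendsto_order_atTop_nhds_top
  refine ENat.tendsto_nhds_top_iff_natCast_lt.mpr
    (fun n => Filter.eventually_atTop.mpr ⟨n + 1, fun j hj => ?_⟩)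
  refine lt_of_lt_of_le (b := ((a * j + b : ℕ) : ℕ∞)) (by norm_cast; nlinarith) ?_
  refine PowerSeries.le_order _ _ fun i hi => ?_
  rw [coeff_C_mul, coeff_X_pow, if_neg, mul_zero]
  rintro rfl
  exact lt_irrefl _ hi

theorem multipliable_qProd (ε : ℤˣ) {a : ℕ} (b : ℕ) (ha : 0 < a) :
    Multipliable fun k : ℕ => 1 - ((ε : ℤ) : ℤ⟦X⟧) * X ^ (a * k + b) := by
  simpa [sub_eq_add_neg] using multipliable_one_add_mul_X_pow (fun _ => -(ε : ℤ)) b ha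

theorem hasProd_qProd (ε : ℤˣ) {a : ℕ} (b : ℕ) (ha : 0 < a) :
    HasProd (fun k : ℕ => 1 - ((ε : ℤ) : ℤ⟦X⟧) * X ^ (a * k + b)) (qProd ε a b) :=
  (multipliable_qProd ε b ha).hasProd

theorem f_eq_qProd (m : ℕ) : f m = qProd 1 m m := by
  simp [f, qProd, mul_add]

theorem qProd_split (ε : ℤˣ) {a : ℕ} (b : ℕ) (ha : 0 < a) (n : ℕ) (hn : 0 < n) :
    qProd ε a b = ∏ r ∈ range n, qProd ε (a * n) (a * r + b) := by
  refine (hasProd_qProd ε b ha).unique (hasProd_nat_of_residues hn fun r _ => ?_)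
  refine (hasProd_qProd ε (a * r + b) (Nat.mul_pos ha hn)).congr_fun fun k => ?_
  ring_nf

theorem qProd_neg_mul {a : ℕ} (b : ℕ) (ha : 0 < a) :
    qProd (-1) a b * qProd 1 a b = qProd 1 (2 * a) (2 * b) := by
  refine ((hasProd_qProd _ b ha).mul (hasProd_qProd _ b ha)).unique
    ((hasProd_qProd 1 (2 * b) (by omega : 0 < 2 * a)).congr_fun fun k => ?_)
  push_cast
  ring

/-! ### The Jacobi triple product, from a finite form with Gaussian binomials. -/

section JacobiTripleProduct

/-- The finite product `∏_{k < n} (1 - q^{a (k + 1)})`. -/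
noncomputable def finProd (a n : ℕ) : ℤ⟦X⟧ := ∏ k ∈ range n, (1 - (X : ℤ⟦X⟧) ^ (a * (k + 1)))

/-- The inverse of `finProd a k`, extended by zero to negative `k`. -/
noncomputable def finProdInv (a : ℕ) (k : ℤ) : ℤ⟦X⟧ :=
  if 0 ≤ k then invOfUnit (finProd a k.toNat) 1 else 0

/-- The Gaussian binomial coefficient `[2n, n + m]` in base `q^a`. -/
noncomputable def centralGauss (a n : ℕ) (m : ℤ) : ℤ⟦X⟧ :=
  finProd a (2 * n) * finProdInv a (n - m) * finProdInv a (n + m)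

theorem finProd_succ (a n : ℕ) :
    finProd a (n + 1) = finProd a n * (1 - X ^ (a * (n + 1))) := by
  rw [finProd, prod_range_succ, finProd]

theorem constantCoeff_finProd {a : ℕ} (ha : 0 < a) (n : ℕ) :
    constantCoeff (finProd a n) = 1 := by
  simp [finProd, map_prod, ha.ne']

theorem finProd_mul_finProdInv {a : ℕ} (ha : 0 < a) (n : ℕ) :
    finProd a n * finProdInv a n = 1 := by
  rw [finProdInv, if_pos (by positivity), Int.toNat_natCast]
  exact mul_invOfUnit _ _ (by simp [constantCoeff_finProd ha])

theorem finProdInv_of_neg {a : ℕ} {k : ℤ} (hk : k < 0) : finProdInv a k = 0 :=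
  if_neg (by omega)

theorem finProdInv_succ {a : ℕ} (ha : 0 < a) (n : ℕ) :
    finProdInv a n = (1 - X ^ (a * (n + 1))) * finProdInv a (n + 1 : ℕ) := by
  have h1 := finProd_mul_finProdInv ha n
  have h2 := finProd_mul_finProdInv ha (n + 1)
  rw [finProd_succ] at h2
  linear_combination (-finProdInv a n) * h2 +
    ((1 - X ^ (a * (n + 1))) * finProdInv a (n + 1 : ℕ)) * h1

theorem centralGauss_eq_zero {a n : ℕ} {m : ℤ} (h : (n : ℤ) < |m|) : centralGauss a n m = 0 := by
  rcases lt_abs.1 h with h | h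
  · rw [centralGauss, finProdInv_of_neg (by omega : (n : ℤ) - m < 0)]; ring
  · rw [centralGauss, finProdInv_of_neg (by omega : (n : ℤ) + m < 0)]; ring

/-- The zero convention at negative indices agrees with the vanishing factor 1 - X^0 at n = 0, so
boundary binomials obey the general recursion. -/
theorem finProdInv_sub_two {a : ℕ} (ha : 0 < a) (n : ℕ) :
    finProdInv a ((n + 1 : ℕ) - 2 : ℤ) =
      (1 - X ^ (a * n)) * (1 - X ^ (a * (n + 1))) * finProdInv a (n + 1 : ℕ) := by
  rcases n with _ | n
  · rw [finProdInv_of_neg (by simp)]; simp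
  · have e : (((n + 1 + 1 : ℕ) : ℤ) - 2) = (n : ℕ) := by push_cast; ring
    rw [e, finProdInv_succ ha n, finProdInv_succ ha (n + 1)]; ring

theorem finProdInv_sub_one {a : ℕ} (ha : 0 < a) (n : ℕ) :
    finProdInv a ((n : ℤ) - 1) = (1 - X ^ (a * n)) * finProdInv a n := by
  rcases n with _ | n
  · rw [finProdInv_of_neg (by simp)]; simp
  · have e : (((n + 1 : ℕ) : ℤ) - 1) = (n : ℕ) := by push_cast; ring
    rw [e, finProdInv_succ ha n]

/-- The q-Pascal rule applied twice, with p = n+1-m and r = n+1+m. With Q = q^a and common factors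
removed it says (1-Q^{p+r-1})(1-Q^{p+r}) = (1+Q^{p+r-1})(1-Q^p)(1-Q^r) + Q^p(1-Q^{r-1})(1-Q^r) +
Q^r(1-Q^{p-1})(1-Q^p). -/
theorem centralGauss_rec_aux {a : ℕ} (ha : 0 < a) {n p r : ℕ} (hpr : p + r = 2 * n + 2) :
    finProd a (2 * n + 2) * finProdInv a p * finProdInv a r =
      finProd a (2 * n) *
        ((1 + X ^ (a * (2 * n + 1))) * (finProdInv a (p - 1) * finProdInv a (r - 1)) +
          X ^ (a * p) * (finProdInv a p * finProdInv a (r - 2)) +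
          X ^ (a * r) * (finProdInv a (p - 2) * finProdInv a r)) := by
  have hs : finProd a (2 * n + 2) =
      finProd a (2 * n) * (1 - X ^ (a * (2 * n + 1))) * (1 - X ^ (a * (2 * n + 2))) := by
    rw [finProd_succ, finProd_succ]
  rw [hs, finProdInv_sub_one ha, finProdInv_sub_one ha]
  rcases p with _ | p
  · obtain rfl : r = 2 * n + 1 + 1 := by omega
    rw [finProdInv_sub_two ha, finProdInv_of_neg (by simp : ((0 : ℕ) : ℤ) - 2 < 0)]
    ring
  rcases r with _ | r
  · obtain rfl : p = 2 * n + 1 := by omega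
    rw [finProdInv_sub_two ha, finProdInv_of_neg (by simp : ((0 : ℕ) : ℤ) - 2 < 0)]
    ring
  obtain hn : 2 * n = p + r := by omega
  rw [finProdInv_sub_two ha, finProdInv_sub_two ha, hn]
  ring

/-- The three terms match the expansion of the new factor (1+εq^{an+b})(1+εq^{an+a-b}) in the finite
product: constant and top term together, then the two cross terms, which shift m. -/
theorem centralGauss_succ {a : ℕ} (ha : 0 < a) (n : ℕ) (m : ℤ) :
    centralGauss a (n + 1) m = (1 + X ^ (a * (2 * n + 1))) * centralGauss a n m +
      X ^ (a * (n - m + 1).toNat) * centralGauss a n (m - 1) +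
      X ^ (a * (n + m + 1).toNat) * centralGauss a n (m + 1) := by
  by_cases hm : (n + 1 : ℤ) < |m|
  · rw [centralGauss_eq_zero (by exact_mod_cast hm), centralGauss_eq_zero (by omega),
      centralGauss_eq_zero, centralGauss_eq_zero]
    · ring
    all_goals rcases lt_abs.1 hm with h | h <;> rw [lt_abs] <;> omega
  · rw [not_lt, abs_le] at hm
    obtain ⟨p, hp⟩ := Int.eq_ofNat_of_zero_le (by omega : 0 ≤ (n : ℤ) - m + 1)
    obtain ⟨r, hr⟩ := Int.eq_ofNat_of_zero_le (by omega : 0 ≤ (n : ℤ) + m + 1)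
    have := centralGauss_rec_aux ha (by omega : p + r = 2 * n + 2)
    rw [hp, hr, Int.toNat_natCast, Int.toNat_natCast]
    simp only [centralGauss]
    rw [show ((n + 1 : ℕ) : ℤ) - m = p by push_cast; omega,
      show ((n + 1 : ℕ) : ℤ) + m = r by push_cast; omega,
      show (n : ℤ) - m = p - 1 by omega, show (n : ℤ) + m = r - 1 by omega,
      show (n : ℤ) - (m - 1) = p by omega, show (n : ℤ) + (m - 1) = r - 2 by omega,
      show (n : ℤ) - (m + 1) = p - 2 by omega, show (n : ℤ) + (m + 1) = r by omega,
      show 2 * (n + 1) = 2 * n + 2 by ring]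
    linear_combination this

variable {a b : ℕ} {e : ℤ → ℕ}

theorem theta_exponent_succ (he : ∀ m : ℤ, 2 * (e m : ℤ) = a * (m * (m - 1)) + 2 * (b * m))
    (m : ℤ) : (e (m + 1) : ℤ) = e m + a * m + b := by
  have h1 := he m
  have h2 := he (m + 1)
  linarith

theorem natAbs_le_theta_exponent (hb : 0 < b) (hab : b < a)
    (he : ∀ m : ℤ, 2 * (e m : ℤ) = a * (m * (m - 1)) + 2 * (b * m)) (m : ℤ) :
    m.natAbs ≤ e m := by
  have h := he m
  have hb' : (1 : ℤ) ≤ b := by exact_mod_cast hb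
  have hab' : (b : ℤ) + 1 ≤ a := by exact_mod_cast hab
  zify
  rcases le_or_gt 0 m with h0 | h0
  · rw [abs_of_nonneg h0]
    have h1 : 0 ≤ m * (m - 1) := by
      rcases h0.eq_or_lt with rfl | h1
      · simp
      · exact mul_nonneg h0 (by omega)
    nlinarith [mul_nonneg (by omega : (0 : ℤ) ≤ a) h1,
      mul_nonneg h0 (by omega : (0 : ℤ) ≤ b - 1)]
  · rw [abs_of_neg h0]
    have h1 : 0 ≤ (-m) * (-m - 1) := mul_nonneg (by omega) (by omega)
    nlinarith [mul_nonneg (by omega : (0 : ℤ) ≤ a) h1,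
      mul_nonneg (by omega : (0 : ℤ) ≤ -m) (by omega : (0 : ℤ) ≤ a - b - 1)]

/-- The terms of the theta series. -/
noncomputable def thetaTerm (ε : ℤˣ) (e : ℤ → ℕ) (m : ℤ) : ℤ⟦X⟧ :=
  (((ε ^ m : ℤˣ) : ℤ) : ℤ⟦X⟧) * X ^ e m

theorem zpow_succ_cast (ε : ℤˣ) (m : ℤ) :
    (((ε ^ (m + 1) : ℤˣ) : ℤ) : ℤ⟦X⟧) = ((ε ^ m : ℤˣ) : ℤ) * (ε : ℤ) := by
  rw [zpow_add, zpow_one]; push_cast; ring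

theorem sign_mul_self (ε : ℤˣ) : ((ε : ℤ) : ℤ⟦X⟧) * (ε : ℤ) = 1 := by
  rw [← Int.cast_mul, ← Units.val_mul, Int.units_mul_self]; simp

/-- The finite form of the Jacobi triple product. -/
theorem hasSum_centralGauss (hb : 0 < b) (hab : b < a) (ε : ℤˣ)
    (he : ∀ m : ℤ, 2 * (e m : ℤ) = a * (m * (m - 1)) + 2 * (b * m)) (n : ℕ) :
    HasSum (fun m : ℤ => centralGauss a n m * thetaTerm ε e m)
      (∏ k ∈ range n, ((1 - (((-ε : ℤˣ) : ℤ) : ℤ⟦X⟧) * X ^ (a * k + b)) *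
        (1 - (((-ε : ℤˣ) : ℤ) : ℤ⟦X⟧) * X ^ (a * k + (a - b))))) := by
  have ha : 0 < a := by omega
  induction n with
  | zero =>
    have e0 : e 0 = 0 := by have := he 0; simp at this; omega
    have h := hasSum_single (f := fun m : ℤ => centralGauss a 0 m * thetaTerm ε e m) 0
      (fun m hm => by
        rw [centralGauss_eq_zero (by simpa using hm), zero_mul])
    convert h using 1
    have h1 := finProd_mul_finProdInv ha 0
    simp only [finProd, range_zero, prod_empty, one_mul, Nat.cast_zero] at h1
    simp [centralGauss, thetaTerm, e0, finProd, h1]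
  | succ n ih =>
    rw [prod_range_succ]
    have s1 := (Equiv.subRight (1 : ℤ)).hasSum_iff.2 ih
    have s2 := (Equiv.addRight (1 : ℤ)).hasSum_iff.2 ih
    have h := ((ih.mul_left (1 + X ^ (a * (2 * n + 1)))).add
      (s1.mul_left (((ε : ℤ) : ℤ⟦X⟧) * X ^ (a * n + b)))).add
      (s2.mul_left (((ε : ℤ) : ℤ⟦X⟧) * X ^ (a * n + (a - b))))
    generalize (∏ k ∈ range n, ((1 - (((-ε : ℤˣ) : ℤ) : ℤ⟦X⟧) * X ^ (a * k + b)) *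
        (1 - (((-ε : ℤˣ) : ℤ) : ℤ⟦X⟧) * X ^ (a * k + (a - b))))) = P at h ⊢
    have hP : P * ((1 - (((-ε : ℤˣ) : ℤ) : ℤ⟦X⟧) * X ^ (a * n + b)) *
          (1 - (((-ε : ℤˣ) : ℤ) : ℤ⟦X⟧) * X ^ (a * n + (a - b)))) =
        (1 + X ^ (a * (2 * n + 1))) * P + ((ε : ℤ) : ℤ⟦X⟧) * X ^ (a * n + b) * P +
          ((ε : ℤ) : ℤ⟦X⟧) * X ^ (a * n + (a - b)) * P := by
      have h5 : (X : ℤ⟦X⟧) ^ (a * n + b) * X ^ (a * n + (a - b)) = X ^ (a * (2 * n + 1)) := by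
        rw [← pow_add]; congr 1; zify [hab.le]; ring
      push_cast
      linear_combination P * (((ε : ℤ) : ℤ⟦X⟧) * (ε : ℤ) * h5 +
        (X : ℤ⟦X⟧) ^ (a * (2 * n + 1)) * sign_mul_self ε)
    rw [hP]
    refine h.congr_fun fun m => ?_
    simp only [Function.comp, Equiv.subRight_apply, Equiv.coe_addRight]
    have t1 : X ^ (a * (n - m + 1).toNat) * centralGauss a n (m - 1) * thetaTerm ε e m =
        ((ε : ℤ) : ℤ⟦X⟧) * X ^ (a * n + b) *
          (centralGauss a n (m - 1) * thetaTerm ε e (m - 1)) := by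
      -- Where `toNat` truncates a negative exponent, the Gaussian coefficient is zero.
      by_cases hm : (n : ℤ) < |m - 1|
      · rw [centralGauss_eq_zero hm]; ring
      rw [not_lt, abs_le] at hm
      have h1 := theta_exponent_succ he (m - 1)
      have h2 := zpow_succ_cast ε (m - 1)
      rw [sub_add_cancel] at h1 h2
      have h3 : a * (n - m + 1).toNat + e m = a * n + b + e (m - 1) := by
        zify
        rw [Int.toNat_of_nonneg (by omega), h1]; ring
      have h4 : (X : ℤ⟦X⟧) ^ (a * (n - m + 1).toNat) * X ^ e m =
          X ^ (a * n + b) * X ^ e (m - 1) := by rw [← pow_add, ← pow_add, h3]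
      rw [thetaTerm, thetaTerm, h2]
      linear_combination (centralGauss a n (m - 1) *
        ((ε ^ (m - 1) : ℤˣ) : ℤ) * (ε : ℤ)) * h4
    have t2 : X ^ (a * (n + m + 1).toNat) * centralGauss a n (m + 1) * thetaTerm ε e m =
        ((ε : ℤ) : ℤ⟦X⟧) * X ^ (a * n + (a - b)) *
          (centralGauss a n (m + 1) * thetaTerm ε e (m + 1)) := by
      by_cases hm : (n : ℤ) < |m + 1|
      · rw [centralGauss_eq_zero hm]; ring
      rw [not_lt, abs_le] at hm
      have h1 := theta_exponent_succ he m
      have h2 := zpow_succ_cast ε m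
      have h3 : a * (n + m + 1).toNat + e m = a * n + (a - b) + e (m + 1) := by
        zify [hab.le]
        rw [Int.toNat_of_nonneg (by omega), h1]; ring
      have h4 : (X : ℤ⟦X⟧) ^ (a * (n + m + 1).toNat) * X ^ e m =
          X ^ (a * n + (a - b)) * X ^ e (m + 1) := by rw [← pow_add, ← pow_add, h3]
      rw [thetaTerm, thetaTerm, h2]
      linear_combination (centralGauss a n (m + 1) * ((ε ^ m : ℤˣ) : ℤ)) * h4 -
        (centralGauss a n (m + 1) * ((ε ^ m : ℤˣ) : ℤ) * X ^ (a * n + (a - b)) * X ^ e (m + 1)) *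
          sign_mul_self ε
    rw [centralGauss_succ ha, add_mul, add_mul, t1, t2]
    ring

theorem X_pow_dvd_finProd_sub (a n k : ℕ) :
    (X : ℤ⟦X⟧) ^ (a * (n + 1)) ∣ finProd a (n + k) - finProd a n := by
  induction k with
  | zero => simp
  | succ k ih =>
    rw [← add_assoc, finProd_succ]
    have h : (X : ℤ⟦X⟧) ^ (a * (n + 1)) ∣ X ^ (a * (n + k + 1)) :=
      pow_dvd_pow _ (Nat.mul_le_mul_left _ (by omega))
    have := dvd_sub ih (h.mul_left (finProd a (n + k)))
    convert this using 1
    ring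

theorem X_pow_dvd_finProd_mul_inv {a : ℕ} (ha : 0 < a) (n k : ℕ) :
    (X : ℤ⟦X⟧) ^ (n + 1) ∣ finProd a (n + k) * finProdInv a n - 1 := by
  have h1 := (X_pow_dvd_finProd_sub a n k).mul_right (finProdInv a n)
  rw [sub_mul, finProd_mul_finProdInv ha] at h1
  exact (pow_dvd_pow _ (Nat.le_mul_of_pos_left _ ha)).trans h1

/-- The product is (Q)_n/(Q)_{n-|m|} times (Q)_{2n}/(Q)_{n+|m|}, and each quotient is 1 +
O(q^{n-|m|+1}). -/
theorem X_pow_dvd_finProd_mul_centralGauss {a : ℕ} (ha : 0 < a) {n k : ℕ} {m : ℤ}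
    (hm : n = m.natAbs + k) :
    (X : ℤ⟦X⟧) ^ (k + 1) ∣ finProd a n * centralGauss a n m - 1 := by
  have key : finProd a n * centralGauss a n m = (finProd a (k + m.natAbs) * finProdInv a k) *
      (finProd a (n + m.natAbs + k) * finProdInv a (n + m.natAbs : ℕ)) := by
    rw [centralGauss, show k + m.natAbs = n by omega, show n + m.natAbs + k = 2 * n by omega]
    rcases Int.natAbs_eq m with h | h
    · rw [show (n : ℤ) - m = (k : ℕ) by omega, show (n : ℤ) + m = (n + m.natAbs : ℕ) by omega]
      ring
    · rw [show (n : ℤ) + m = (k : ℕ) by omega, show (n : ℤ) - m = (n + m.natAbs : ℕ) by omega]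
      ring
  have h1 := X_pow_dvd_finProd_mul_inv ha k m.natAbs
  have h2 := (pow_dvd_pow (X : ℤ⟦X⟧) (by omega : k + 1 ≤ n + m.natAbs + 1)).trans
    (X_pow_dvd_finProd_mul_inv ha (n + m.natAbs) k)
  rw [key]
  convert dvd_add (h1.mul_right (finProd a (n + m.natAbs + k) * finProdInv a (n + m.natAbs : ℕ))) h2
    using 1
  ring

theorem summable_thetaTerm (hb : 0 < b) (hab : b < a) (ε : ℤˣ)
    (he : ∀ m : ℤ, 2 * (e m : ℤ) = a * (m * (m - 1)) + 2 * (b * m)) :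
    Summable (thetaTerm ε e) := by
  rw [PowerSeries.WithPiTopology.summable_iff_summable_coeff]
  intro d
  refine summable_of_hasFiniteSupport ((Set.finite_Icc (-(d : ℤ)) d).subset fun m hm => ?_)
  by_contra hcon
  refine hm ?_
  have := natAbs_le_theta_exponent hb hab he m
  have h1 : X ^ (d + 1) ∣ thetaTerm ε e m :=
    Dvd.dvd.mul_left (pow_dvd_pow _ (by rw [Set.mem_Icc] at hcon; omega)) _
  exact X_pow_dvd_iff.1 h1 d (by omega)

theorem tendsto_prod_theta (hb : 0 < b) (hab : b < a) (ε : ℤˣ)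
    (he : ∀ m : ℤ, 2 * (e m : ℤ) = a * (m * (m - 1)) + 2 * (b * m)) {S : ℤ⟦X⟧}
    (hS : HasSum (thetaTerm ε e) S) :
    Tendsto (fun n => finProd a n *
      ∏ k ∈ range n, ((1 - (((-ε : ℤˣ) : ℤ) : ℤ⟦X⟧) * X ^ (a * k + b)) *
        (1 - (((-ε : ℤˣ) : ℤ) : ℤ⟦X⟧) * X ^ (a * k + (a - b))))) atTop (nhds S) := by
  rw [PowerSeries.WithPiTopology.tendsto_iff_coeff_tendsto]
  intro d
  refine tendsto_atTop_of_eventually_const (i₀ := d) fun n hn => ?_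
  rw [← sub_eq_zero, ← map_sub]
  have h := ((hasSum_centralGauss hb hab ε he n).mul_left (finProd a n)).sub hS
  refine (((PowerSeries.WithPiTopology.hasSum_iff_hasSum_coeff (R := ℤ)).1 h d).unique ?_)
  convert hasSum_zero with m
  -- The binomial error O(q^{n-|m|+1}) meets a theta term that is O(q^{|m|}), so the bound q^{n+1}
  -- is uniform in m; for |m| > n the theta term alone is small enough.
  have hdvd : (X : ℤ⟦X⟧) ^ (n + 1) ∣
      finProd a n * (centralGauss a n m * thetaTerm ε e m) - thetaTerm ε e m := by
    have hT : (X : ℤ⟦X⟧) ^ m.natAbs ∣ thetaTerm ε e m :=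
      Dvd.dvd.mul_left (pow_dvd_pow _ (natAbs_le_theta_exponent hb hab he m)) _
    by_cases hm : m.natAbs ≤ n
    · obtain ⟨k, hk⟩ := Nat.exists_eq_add_of_le hm
      have := mul_dvd_mul (X_pow_dvd_finProd_mul_centralGauss (by omega : 0 < a) hk) hT
      rw [← pow_add] at this
      convert this using 1
      · congr 1; omega
      · ring
    · rw [centralGauss_eq_zero (by rw [Int.abs_eq_natAbs]; omega)]
      simpa using (pow_dvd_pow X (by omega : n + 1 ≤ m.natAbs)).trans hT
  exact X_pow_dvd_iff.1 hdvd d (by omega)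

/-- The **Jacobi triple product** for formal power series. -/
theorem hasSum_thetaTerm (hb : 0 < b) (hab : b < a) (ε : ℤˣ)
    (he : ∀ m : ℤ, 2 * (e m : ℤ) = a * (m * (m - 1)) + 2 * (b * m)) :
    HasSum (thetaTerm ε e) (f a * (qProd (-ε) a b * qProd (-ε) a (a - b))) := by
  have ha : 0 < a := by omega
  have hS := (summable_thetaTerm hb hab ε he).hasSum
  convert hS
  refine tendsto_nhds_unique ?_ (tendsto_prod_theta hb hab ε he hS)
  have h1 := (multipliable_f ha).hasProd.tendsto_prod_nat
  have h2 := (((hasProd_qProd (-ε) b ha).mul (hasProd_qProd (-ε) (a - b) ha))).tendsto_prod_nat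
  exact h1.mul h2

end JacobiTripleProduct

/-! ### Quotients of the f_m as theta series. -/

theorem continuous_expand {R : Type*} [CommRing R] [TopologicalSpace R] (p : ℕ) (hp : p ≠ 0) :
    Continuous (expand p hp : R⟦X⟧ →ₐ[R] R⟦X⟧) := by
  rw [continuous_iff_continuousAt]
  intro F
  refine (PowerSeries.WithPiTopology.tendsto_iff_coeff_tendsto R _ _ _).2 fun d => ?_
  simp only [coeff_expand]
  split_ifs
  · exact ((PowerSeries.WithPiTopology.continuous_coeff R _).tendsto F)
  · exact tendsto_const_nhds

theorem expand_f (p : ℕ) (hp : p ≠ 0) {m : ℕ} (hm : 0 < m) : expand p hp (f m) = f (p * m) := by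
  rw [f, (multipliable_f hm).map_tprod _ (continuous_expand p hp), f]
  refine tprod_congr fun j => ?_
  simp [← pow_mul, mul_assoc]

/-- The inverse of `f m`. -/
noncomputable def fInv (m : ℕ) : ℤ⟦X⟧ := invOfUnit (f m) 1

theorem f_mul_fInv {m : ℕ} (hm : 0 < m) : f m * fInv m = 1 :=
  mul_invOfUnit _ _ (by rw [constantCoeff_f hm, Units.val_one])

theorem f_ne_zero {m : ℕ} (hm : 0 < m) : f m ≠ 0 :=
  left_ne_zero_of_mul_eq_one (f_mul_fInv hm)

theorem expand_fInv (p : ℕ) (hp : p ≠ 0) {m : ℕ} (hm : 0 < m) :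
    expand p hp (fInv m) = fInv (p * m) := by
  have h1 := congrArg (expand p hp) (f_mul_fInv hm)
  rw [map_mul, map_one, expand_f p hp hm] at h1
  have h2 := f_mul_fInv (Nat.mul_pos (Nat.pos_of_ne_zero hp) hm)
  linear_combination (-expand p hp (fInv m)) * h2 + fInv (p * m) * h1

/-- `φ(-q) = f_1^2 / f_2`. -/
noncomputable def phi : ℤ⟦X⟧ := f 1 ^ 2 * fInv 2

/-- `φ(q) = f_2^5 / (f_1^2 f_4^2)`. -/
noncomputable def phiPos : ℤ⟦X⟧ := f 2 ^ 5 * fInv 1 ^ 2 * fInv 4 ^ 2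

/-- `ψ(q) = f_2^2 / f_1`. -/
noncomputable def psi : ℤ⟦X⟧ := f 2 ^ 2 * fInv 1

/-- `f_2 f_3^2 / (f_1 f_6)`. -/
noncomputable def thetaA : ℤ⟦X⟧ := f 2 * f 3 ^ 2 * fInv 1 * fInv 6

/-- `f_1 f_6^2 / (f_2 f_3)`. -/
noncomputable def omega : ℤ⟦X⟧ := f 1 * f 6 ^ 2 * fInv 2 * fInv 3

theorem qProd_two_one : qProd 1 2 1 * f 2 = f 1 := by
  rw [f_eq_qProd 1, qProd_split 1 1 one_pos 2 two_pos, f_eq_qProd]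
  simp [prod_range_succ]

theorem qProd_neg_two_one : qProd (-1) 2 1 * (f 1 * f 4) = f 2 ^ 2 := by
  have h1 := qProd_neg_mul 1 two_pos
  have h2 : qProd 1 4 2 * f 4 = f 2 := by
    rw [f_eq_qProd 2, qProd_split 1 2 two_pos 2 two_pos, f_eq_qProd]
    simp [prod_range_succ]
  have h3 := qProd_two_one
  norm_num at h1
  linear_combination (-qProd (-1) 2 1 * f 4) * h3 + f 4 * f 2 * h1 + f 2 * h2

theorem qProd_three : qProd 1 3 1 * qProd 1 3 2 * f 3 = f 1 := by
  rw [f_eq_qProd 1, qProd_split 1 1 one_pos 3 three_pos, f_eq_qProd]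
  simp [prod_range_succ]

theorem qProd_six : qProd 1 6 2 * qProd 1 6 4 * f 6 = f 2 := by
  rw [f_eq_qProd 2, qProd_split 1 2 two_pos 3 three_pos, f_eq_qProd]
  simp [prod_range_succ]

theorem qProd_neg_three :
    qProd (-1) 3 2 * qProd (-1) 3 1 * (f 1 * f 6) = f 2 * f 3 := by
  have h1 := qProd_neg_mul 1 three_pos
  have h2 := qProd_neg_mul 2 three_pos
  norm_num at h1 h2
  have h3 := qProd_three
  have h4 := qProd_six
  linear_combination (-qProd (-1) 3 2 * qProd (-1) 3 1 * f 6) * h3 + f 3 * h4 +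
    f 6 * f 3 * (qProd (-1) 3 2 * qProd 1 3 2 * h1 + qProd 1 6 2 * h2)

theorem qProd_six_odd : qProd 1 6 5 * qProd 1 6 1 * (f 2 * f 3) = f 1 * f 6 := by
  have h1 : qProd 1 2 1 = qProd 1 6 1 * qProd 1 6 3 * qProd 1 6 5 := by
    rw [qProd_split 1 1 two_pos 3 three_pos]
    simp [prod_range_succ]
  have h2 : qProd 1 6 3 * f 6 = f 3 := by
    rw [f_eq_qProd 3, qProd_split 1 3 three_pos 2 two_pos, f_eq_qProd]
    simp [prod_range_succ]
  have h3 := qProd_two_one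
  linear_combination (-qProd 1 6 5 * qProd 1 6 1 * f 2) * h2 + f 6 * h3 - f 2 * f 6 * h1

/-- Exponents of the theta series for `φ`. -/
def sqExp (m : ℤ) : ℕ := (m ^ 2).toNat

/-- Exponents of the theta series for `ψ`. -/
def psiExp (m : ℤ) : ℕ := (2 * m ^ 2 + m).toNat

/-- Exponents of the theta series for `thetaA`: generalized pentagonal numbers. -/
def thetaAExp (m : ℤ) : ℕ := ((3 * m ^ 2 + m) / 2).toNat

/-- Exponents of the theta series for `omega`. -/
def omegaExp (m : ℤ) : ℕ := (3 * m ^ 2 + 2 * m).toNat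

theorem sqExp_cast (m : ℤ) : (sqExp m : ℤ) = m ^ 2 := Int.toNat_of_nonneg (sq_nonneg m)

theorem quadratic_nonneg {a b m : ℤ} (hb : 0 ≤ b) (hab : b ≤ a) : 0 ≤ a * m ^ 2 + b * m := by
  rcases le_or_gt 0 m with h | h
  · have : 0 ≤ a := hb.trans hab
    positivity
  · nlinarith [mul_nonneg hb (by nlinarith : 0 ≤ m * (m + 1)),
      mul_nonneg (sub_nonneg.2 hab) (sq_nonneg m)]

theorem psiExp_cast (m : ℤ) : (psiExp m : ℤ) = 2 * m ^ 2 + m := by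
  have := quadratic_nonneg (a := 2) (b := 1) (m := m) (by norm_num) (by norm_num)
  exact Int.toNat_of_nonneg (by linarith)

theorem omegaExp_cast (m : ℤ) : (omegaExp m : ℤ) = 3 * m ^ 2 + 2 * m :=
  Int.toNat_of_nonneg (quadratic_nonneg (by norm_num) (by norm_num))

theorem two_mul_thetaAExp (m : ℤ) : 2 * (thetaAExp m : ℤ) = 3 * m ^ 2 + m := by
  have h := quadratic_nonneg (a := 3) (b := 1) (m := m) (by norm_num) (by norm_num)
  have h2 : (2 : ℤ) ∣ 3 * m ^ 2 + m := by
    rw [show 3 * m ^ 2 + m = m * (m + 1) + 2 * m ^ 2 by ring]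
    exact dvd_add (Int.even_mul_succ_self m).two_dvd (Dvd.intro (m ^ 2) rfl)
  rw [thetaAExp, Int.toNat_of_nonneg (by omega)]
  omega

theorem hasSum_phi : HasSum (thetaTerm (-1) sqExp) phi := by
  have h := hasSum_thetaTerm (a := 2) (b := 1) (e := sqExp) one_pos one_lt_two (-1)
    (fun m => by rw [sqExp_cast]; push_cast; ring)
  have h1 := f_mul_fInv two_pos
  have h2 := qProd_two_one
  convert h using 1
  norm_num
  rw [phi, ← h2]
  linear_combination (f 2 * qProd 1 2 1 ^ 2) * h1

theorem hasSum_phiPos : HasSum (thetaTerm 1 sqExp) phiPos := by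
  have h := hasSum_thetaTerm (a := 2) (b := 1) (e := sqExp) one_pos one_lt_two 1
    (fun m => by rw [sqExp_cast]; push_cast; ring)
  have h1 := f_mul_fInv one_pos
  have h4 := f_mul_fInv four_pos
  have h2 := qProd_neg_two_one
  have h3 : qProd (-1) 2 1 = f 2 ^ 2 * fInv 1 * fInv 4 := by
    linear_combination fInv 1 * fInv 4 * h2 - qProd (-1) 2 1 * (f 1 * fInv 1) * h4 -
      qProd (-1) 2 1 * h1
  convert h using 1
  norm_num
  rw [phiPos, h3]
  ring

theorem hasSum_psi : HasSum (thetaTerm 1 psiExp) psi := by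
  -- Choosing b = 3 rather than 1 gives 2m(m-1) + 3m = 2m² + m, the exponent of `psiExp`.
  have h := hasSum_thetaTerm (a := 4) (b := 3) (e := psiExp) three_pos (by norm_num) 1
    (fun m => by rw [psiExp_cast]; push_cast; ring)
  have h1 := f_mul_fInv one_pos
  have h2 := qProd_neg_two_one
  have h3 : qProd (-1) 2 1 = qProd (-1) 4 1 * qProd (-1) 4 3 := by
    rw [qProd_split (-1) 1 two_pos 2 two_pos]
    simp [prod_range_succ]
  convert h using 1
  norm_num
  rw [psi, ← h2]
  linear_combination (qProd (-1) 2 1 * f 4) * h1 + f 4 * h3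

theorem hasSum_thetaA : HasSum (thetaTerm 1 thetaAExp) thetaA := by
  have h := hasSum_thetaTerm (a := 3) (b := 2) (e := thetaAExp) two_pos (by norm_num) 1
    (fun m => by rw [two_mul_thetaAExp]; push_cast; ring)
  have h1 := f_mul_fInv one_pos
  have h6 := f_mul_fInv (by norm_num : 0 < 6)
  have h2 := qProd_neg_three
  convert h using 1
  norm_num
  rw [thetaA]
  linear_combination (-f 3 * fInv 1 * fInv 6) * h2 +
    f 3 * (qProd (-1) 3 2 * qProd (-1) 3 1) * (f 1 * fInv 1 * h6 + h1)

theorem hasSum_omega : HasSum (thetaTerm (-1) omegaExp) omega := by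
  have h := hasSum_thetaTerm (a := 6) (b := 5) (e := omegaExp) (by norm_num) (by norm_num) (-1)
    (fun m => by rw [omegaExp_cast]; push_cast; ring)
  have h3 := f_mul_fInv three_pos
  have h6 := f_mul_fInv two_pos
  have h2 := qProd_six_odd
  convert h using 1
  norm_num
  rw [omega]
  linear_combination (-f 6 * fInv 2 * fInv 3) * h2 +
    f 6 * (qProd 1 6 5 * qProd 1 6 1) * (f 2 * fInv 2 * h3 + h6)

/-! ### 3- and 4-dissections of the theta series. -/

theorem thetaTerm_eq_expand {ε ε' : ℤˣ} {e e' : ℤ → ℕ} {s : ℤ⟦X⟧} {c p : ℕ} (hp : p ≠ 0)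
    {m k : ℤ} (hs : (((ε ^ m : ℤˣ) : ℤ) : ℤ⟦X⟧) = s * ((ε' ^ k : ℤˣ) : ℤ))
    (he : (e m : ℤ) = c + p * e' k) :
    thetaTerm ε e m = s * X ^ c * expand p hp (thetaTerm ε' e' k) := by
  have he' : e m = c + p * e' k := by exact_mod_cast he
  rw [thetaTerm, thetaTerm, hs, he', map_mul, map_pow, expand_X, map_intCast]
  ring

theorem hasSum_expand {ε : ℤˣ} {e : ℤ → ℕ} {S : ℤ⟦X⟧} (h : HasSum (thetaTerm ε e) S)
    (s : ℤ⟦X⟧) {p : ℕ} (hp : p ≠ 0) :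
    HasSum (fun k => s * expand p hp (thetaTerm ε e k)) (s * expand p hp S) :=
  (h.map _ (continuous_expand p hp)).mul_left s

theorem neg_one_zpow_cast_odd {m k : ℤ} (h : Odd (m - k)) :
    ((((-1) ^ m : ℤˣ) : ℤ) : ℤ⟦X⟧) = -1 * (((-1) ^ k : ℤˣ) : ℤ) := by
  rw [← sub_add_cancel m k, zpow_add, h.neg_one_zpow]
  simp

theorem neg_one_zpow_cast_even {m k : ℤ} (h : Even (m - k)) :
    ((((-1) ^ m : ℤˣ) : ℤ) : ℤ⟦X⟧) = 1 * (((-1) ^ k : ℤˣ) : ℤ) := by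
  rw [← sub_add_cancel m k, zpow_add, h.neg_one_zpow]
  simp

theorem phi_three_dissection :
    phi = expand 9 (by norm_num) phi - 2 * X * expand 3 (by norm_num) omega := by
  have key := hasSum_int_of_residues (h := thetaTerm (-1) sqExp) (n := 3)
    (P := fun r => if r = 0 then expand 9 (by norm_num) phi
      else -1 * X ^ 1 * expand 3 (by norm_num) omega) (by norm_num) (fun r hr => ?_)
  · refine (hasSum_phi.unique key).trans ?_
    simp [sum_range_succ]
    ring
  · rw [Finset.mem_range] at hr
    interval_cases r
    · simp only [if_true]
      have := hasSum_expand hasSum_phi (1 * X ^ 0) (p := 9) (by norm_num)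
      simp only [pow_zero, mul_one, one_mul] at this
      refine this.congr_fun fun k => ?_
      rw [thetaTerm_eq_expand (ε' := -1) (e' := sqExp) (k := k) (s := 1) (c := 0) (p := 9)
        (by norm_num) (neg_one_zpow_cast_even ⟨k, by push_cast; ring⟩)
        (by rw [sqExp_cast, sqExp_cast]; push_cast; ring)]
      simp
    · simp only [one_ne_zero, if_false]
      refine (hasSum_expand hasSum_omega (-1 * X ^ 1) (p := 3) (by norm_num)).congr_fun
        fun k => ?_
      rw [thetaTerm_eq_expand (ε' := -1) (e' := omegaExp) (k := k) (s := -1) (c := 1) (p := 3)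
        (by norm_num) (neg_one_zpow_cast_odd ⟨k, by push_cast; ring⟩)
        (by rw [sqExp_cast, omegaExp_cast]; push_cast; ring)]
    · simp only [OfNat.ofNat_ne_zero, if_false]
      -- The reflection k ↦ -1-k sends 3k+2 to -(3k+1), so class 2 repeats the sum of class 1.
      refine ((Equiv.subLeft (-1 : ℤ)).hasSum_iff.2
        (hasSum_expand hasSum_omega (-1 * X ^ 1) (p := 3) (by norm_num))).congr_fun fun k => ?_
      rw [thetaTerm_eq_expand (ε' := -1) (e' := omegaExp) (k := -1 - k) (s := -1) (c := 1) (p := 3)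
        (by norm_num) (neg_one_zpow_cast_odd ⟨2 * k + 1, by push_cast; ring⟩)
        (by rw [sqExp_cast, omegaExp_cast]; push_cast; ring)]
      rfl

theorem one_zpow_cast (m k : ℤ) :
    (((1 ^ m : ℤˣ) : ℤ) : ℤ⟦X⟧) = 1 * ((1 ^ k : ℤˣ) : ℤ) := by simp

/-- Even squares are 4k²; odd ones are (4k±1)² = 8(2k²±k) + 1, and each sign gives a full copy of
ψ(q^8). The sign ε covers φ(q) and φ(-q) together. -/
theorem sq_four_dissection {ε : ℤˣ} {S : ℤ⟦X⟧} (hS : HasSum (thetaTerm ε sqExp) S) :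
    S = expand 4 (by norm_num) phiPos +
      2 * ((ε : ℤ) : ℤ⟦X⟧) * X * expand 8 (by norm_num) psi := by
  have hε : ∀ m k : ℤ, Odd m →
      (((ε ^ m : ℤˣ) : ℤ) : ℤ⟦X⟧) = ((ε : ℤ) : ℤ⟦X⟧) * ((1 ^ k : ℤˣ) : ℤ) := by
    rintro m k ⟨j, rfl⟩
    rw [zpow_add, zpow_mul, zpow_one]
    rcases Int.units_eq_one_or ε with rfl | rfl <;> simp
  have hε' : ∀ m k : ℤ, Even m → (((ε ^ m : ℤˣ) : ℤ) : ℤ⟦X⟧) = 1 * ((1 ^ k : ℤˣ) : ℤ) := by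
    rintro m k ⟨j, rfl⟩
    rw [← two_mul, zpow_mul]
    rcases Int.units_eq_one_or ε with rfl | rfl <;> simp
  have hodd := hasSum_int_of_residues (h := fun k => thetaTerm ε sqExp (2 * k + 1)) (n := 2)
    (P := fun _ => ((ε : ℤ) : ℤ⟦X⟧) * X ^ 1 * expand 8 (by norm_num) psi) (by norm_num)
    (fun r hr => ?_)
  · have key := hasSum_int_of_residues (h := thetaTerm ε sqExp) (n := 2)
      (P := fun r => if r = 0 then expand 4 (by norm_num) phiPos
        else ∑ r ∈ range 2, ((ε : ℤ) : ℤ⟦X⟧) * X ^ 1 * expand 8 (by norm_num) psi)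
      (by norm_num) (fun r hr => ?_)
    · refine (hS.unique key).trans ?_
      simp [sum_range_succ]
      ring
    · rw [Finset.mem_range] at hr
      interval_cases r
      · simp only [if_true]
        have := hasSum_expand hasSum_phiPos (1 * X ^ 0) (p := 4) (by norm_num)
        simp only [pow_zero, mul_one, one_mul] at this
        refine this.congr_fun fun k => ?_
        rw [thetaTerm_eq_expand (ε' := 1) (e' := sqExp) (k := k) (s := 1) (c := 0) (p := 4)
          (by norm_num) (hε' _ _ ⟨k, by push_cast; ring⟩)
          (by rw [sqExp_cast, sqExp_cast]; push_cast; ring)]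
        simp
      · simp only [one_ne_zero, if_false]
        exact hodd
  · rw [Finset.mem_range] at hr
    interval_cases r
    · refine (hasSum_expand hasSum_psi (((ε : ℤ) : ℤ⟦X⟧) * X ^ 1) (p := 8)
        (by norm_num)).congr_fun fun k => ?_
      rw [thetaTerm_eq_expand (ε' := 1) (e' := psiExp) (k := k) (s := (ε : ℤ)) (c := 1) (p := 8)
        (by norm_num) (hε _ _ ⟨2 * k, by push_cast; ring⟩)
        (by rw [sqExp_cast, psiExp_cast]; push_cast; ring)]
    · refine ((Equiv.subLeft (-1 : ℤ)).hasSum_iff.2 (hasSum_expand hasSum_psi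
        (((ε : ℤ) : ℤ⟦X⟧) * X ^ 1) (p := 8) (by norm_num))).congr_fun fun k => ?_
      rw [thetaTerm_eq_expand (ε' := 1) (e' := psiExp) (k := -1 - k) (s := (ε : ℤ)) (c := 1)
        (p := 8) (by norm_num) (hε _ _ ⟨2 * k + 1, by push_cast; ring⟩)
        (by rw [sqExp_cast, psiExp_cast]; push_cast; ring)]
      rfl

theorem phi_four_dissection :
    phi = expand 4 (by norm_num) phiPos - 2 * X * expand 8 (by norm_num) psi := by
  have := sq_four_dissection hasSum_phi
  push_cast at this
  linear_combination this

theorem phiPos_four_dissection :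
    phiPos = expand 4 (by norm_num) phiPos + 2 * X * expand 8 (by norm_num) psi := by
  have := sq_four_dissection hasSum_phiPos
  push_cast at this
  linear_combination this

/-- Classes 0 and 1 mod 3 supply the even- and odd-indexed terms of `thetaA`, which is why that
series is first cut into S₀ + S₁; class 2 reproduces ψ(q^9). -/
theorem psi_three_dissection :
    psi = expand 3 (by norm_num) thetaA + X * expand 9 (by norm_num) psi := by
  have inj : ∀ r : ℤ, Function.Injective (fun k : ℤ => 2 * k + r) := fun r x y h => by
    simpa using h
  obtain ⟨S₀, h₀⟩ := hasSum_thetaA.summable.comp_injective (inj 0)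
  obtain ⟨S₁, h₁⟩ := hasSum_thetaA.summable.comp_injective (inj 1)
  have hA : thetaA = S₀ + S₁ := by
    have key := hasSum_int_of_residues (h := thetaTerm 1 thetaAExp) (n := 2)
      (P := fun r => if r = 0 then S₀ else S₁) (by norm_num) (fun r hr => ?_)
    · rw [hasSum_thetaA.unique key]
      simp [sum_range_succ]
    · rw [Finset.mem_range] at hr
      interval_cases r
      · exact h₀
      · exact h₁
  have key := hasSum_int_of_residues (h := thetaTerm 1 psiExp) (n := 3)
    (P := fun r => if r = 0 then expand 3 (by norm_num) S₀ else if r = 1 then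
      expand 3 (by norm_num) S₁ else 1 * X ^ 1 * expand 9 (by norm_num) psi) (by norm_num)
    (fun r hr => ?_)
  · refine (hasSum_psi.unique key).trans ?_
    rw [hA]
    simp [sum_range_succ]
  · rw [Finset.mem_range] at hr
    interval_cases r
    · refine (h₀.map _ (continuous_expand 3 (by norm_num))).congr_fun fun k => ?_
      rw [thetaTerm_eq_expand (ε' := 1) (e' := thetaAExp) (k := 2 * k + 0) (s := 1) (c := 0)
        (p := 3) (by norm_num) (one_zpow_cast _ _) ?_]
      · simp
      · have := two_mul_thetaAExp (2 * k + 0)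
        rw [psiExp_cast]; push_cast; linarith
    · refine ((Equiv.subLeft (-1 : ℤ)).hasSum_iff.2
        (h₁.map _ (continuous_expand 3 (by norm_num)))).congr_fun fun k => ?_
      rw [thetaTerm_eq_expand (ε' := 1) (e' := thetaAExp) (k := 2 * (-1 - k) + 1) (s := 1)
        (c := 0) (p := 3) (by norm_num) (one_zpow_cast _ _) ?_]
      · simp
      · have := two_mul_thetaAExp (2 * (-1 - k) + 1)
        rw [psiExp_cast]; push_cast; linarith
    · simp only [OfNat.ofNat_ne_zero, if_false, OfNat.ofNat_ne_one]
      refine ((Equiv.subLeft (-1 : ℤ)).hasSum_iff.2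
        (hasSum_expand hasSum_psi (1 * X ^ 1) (p := 9) (by norm_num))).congr_fun fun k => ?_
      rw [thetaTerm_eq_expand (ε' := 1) (e' := psiExp) (k := -1 - k) (s := 1) (c := 1) (p := 9)
        (by norm_num) (one_zpow_cast _ _) (by rw [psiExp_cast, psiExp_cast]; push_cast; ring)]
      rfl

/-! ### Norms under q ↦ wq for a cube root of unity w, and cubic theta relations. -/

section CubicNorm

/-- Extension of scalars `ℤ⟦X⟧ → ℂ⟦X⟧`. -/
noncomputable def toComplex : ℤ⟦X⟧ →+* ℂ⟦X⟧ := PowerSeries.map (Int.castRingHom ℂ)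

theorem toComplex_injective : Function.Injective toComplex :=
  PowerSeries.map_injective _ Int.cast_injective

theorem continuous_toComplex : Continuous toComplex := by
  rw [continuous_iff_continuousAt]
  intro F
  refine (PowerSeries.WithPiTopology.tendsto_iff_coeff_tendsto ℂ _ _ _).2 fun d => ?_
  simp only [toComplex, coeff_map]
  exact (continuous_of_discreteTopology (f := Int.castRingHom ℂ)).continuousAt.tendsto.comp
    ((PowerSeries.WithPiTopology.continuous_coeff ℤ d).tendsto F)

theorem continuous_rescale (w : ℂ) : Continuous (rescale w : ℂ⟦X⟧ →+* ℂ⟦X⟧) := by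
  rw [continuous_iff_continuousAt]
  intro F
  refine (PowerSeries.WithPiTopology.tendsto_iff_coeff_tendsto ℂ _ _ _).2 fun d => ?_
  simp only [coeff_rescale]
  exact ((PowerSeries.WithPiTopology.continuous_coeff ℂ d).tendsto F).const_mul _

theorem hasProd_toComplex_f {m : ℕ} (hm : 0 < m) :
    HasProd (fun j : ℕ => 1 - (X : ℂ⟦X⟧) ^ (m * (j + 1))) (toComplex (f m)) := by
  refine ((multipliable_f hm).hasProd.map toComplex continuous_toComplex).congr_fun fun j => ?_
  simp [toComplex]

theorem rescale_X_complex (w : ℂ) : rescale w (X : ℂ⟦X⟧) = C w * X := by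
  ext n
  rw [coeff_rescale, coeff_C_mul, coeff_X]
  split_ifs with h <;> simp [h]

theorem hasProd_rescale_f (w : ℂ) {m : ℕ} (hm : 0 < m) :
    HasProd (fun j : ℕ => 1 - C (w ^ (m * (j + 1))) * (X : ℂ⟦X⟧) ^ (m * (j + 1)))
      (rescale w (toComplex (f m))) := by
  refine ((hasProd_toComplex_f hm).map (rescale w) (continuous_rescale w)).congr_fun fun j => ?_
  simp [mul_pow]

/-- The product of the three conjugates of a series under `q ↦ w q`. -/
noncomputable def cubicNorm (w : ℂ) (F : ℤ⟦X⟧) : ℂ⟦X⟧ :=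
  toComplex F * rescale w (toComplex F) * rescale (w ^ 2) (toComplex F)

theorem cubicNorm_mul (w : ℂ) (F G : ℤ⟦X⟧) :
    cubicNorm w (F * G) = cubicNorm w F * cubicNorm w G := by
  simp only [cubicNorm, map_mul]
  ring

theorem cubicNorm_pow (w : ℂ) (F : ℤ⟦X⟧) (n : ℕ) :
    cubicNorm w (F ^ n) = cubicNorm w F ^ n := by
  simp only [cubicNorm, map_pow]
  ring

variable {w : ℂ} (hw : w ^ 2 + w + 1 = 0)

include hw in
theorem root_pow_three : w ^ 3 = 1 := by linear_combination (w - 1) * hw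

-- For 3 ∤ k the numbers 1, w^k, w^{2k} are the three cube roots of unity.
include hw in
theorem prod_conj (k : ℕ) (hk : ¬ 3 ∣ k) (Y : ℂ⟦X⟧) :
    (1 - Y) * (1 - C (w ^ k) * Y) * (1 - C ((w ^ 2) ^ k) * Y) = 1 - Y ^ 3 := by
  have h3 := root_pow_three hw
  have key : (w ^ k) ^ 2 + w ^ k + 1 = 0 := by
    rw [← Nat.div_add_mod k 3, pow_add, pow_mul, h3, one_pow, one_mul]
    have : k % 3 < 3 := Nat.mod_lt _ (by norm_num)
    have : k % 3 ≠ 0 := fun h => hk (Nat.dvd_of_mod_eq_zero h)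
    interval_cases k % 3
    · exact absurd rfl this
    · linear_combination hw
    · linear_combination hw + w * h3
  have keyC : (C (w ^ k) : ℂ⟦X⟧) ^ 2 + C (w ^ k) + 1 = 0 := by
    rw [← map_one C, ← map_pow, ← map_add, ← map_add, key, map_zero]
  have h2 : (C ((w ^ 2) ^ k) : ℂ⟦X⟧) = C (w ^ k) ^ 2 := by
    rw [← map_pow, ← pow_mul, ← pow_mul, mul_comm]
  rw [h2]
  linear_combination (-Y + C (w ^ k) * Y ^ 2 + (1 - C (w ^ k)) * Y ^ 3) * keyC

-- Conjugate factors with exponent prime to 3 merge into 1 - q^{3mk}, 3 ∤ k; the factors with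
-- exponent divisible by 3 are fixed and get cubed. Hence the norm is f_{3m}^4/f_{9m}.
include hw in
theorem cubicNorm_f {m : ℕ} (hm : 0 < m) (h3 : ¬ 3 ∣ m) :
    cubicNorm w (f m) * toComplex (f (9 * m)) = toComplex (f (3 * m)) ^ 4 := by
  have hp (r : ℕ) : HasProd (fun k : ℕ => 1 - (X : ℂ⟦X⟧) ^ (9 * m * k + 3 * m * (r + 1)))
      (∏' k : ℕ, (1 - (X : ℂ⟦X⟧) ^ (9 * m * k + 3 * m * (r + 1)))) := by
    have := multipliable_one_add_mul_X_pow (fun _ => (-1 : ℂ)) (a := 9 * m) (3 * m * (r + 1))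
      (by omega)
    refine Multipliable.hasProd ?_
    simpa [sub_eq_add_neg] using this
  set P : ℕ → ℂ⟦X⟧ := fun r => ∏' k : ℕ, (1 - (X : ℂ⟦X⟧) ^ (9 * m * k + 3 * m * (r + 1)))
  have hF : toComplex (f (3 * m)) = ∏ r ∈ range 3, P r := by
    refine (hasProd_toComplex_f (by omega)).unique
      (hasProd_nat_of_residues (by norm_num) fun r _ => (hp r).congr_fun fun k => ?_)
    congr 2
    ring
  have h9 : toComplex (f (9 * m)) = P 2 := by
    refine (hasProd_toComplex_f (by omega)).unique ((hp 2).congr_fun fun k => ?_)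
    congr 2
    ring
  have hN : cubicNorm w (f m) = ∏ r ∈ range 3, if r = 2 then toComplex (f (3 * m)) ^ 3 else P r := by
    refine (((hasProd_toComplex_f hm).mul (hasProd_rescale_f w hm)).mul
      (hasProd_rescale_f (w ^ 2) hm)).unique
      (hasProd_nat_of_residues (by norm_num) fun r hr => ?_)
    rw [Finset.mem_range] at hr
    have hne : ∀ k, r ≠ 2 → ¬ 3 ∣ m * (3 * k + r + 1) := fun k hr2 hdvd => by
      rcases (Nat.Prime.dvd_mul Nat.prime_three).1 hdvd with h | h
      · exact h3 h
      · omega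
    split_ifs with hr2
    · subst hr2
      have h := hasProd_toComplex_f (by omega : 0 < 3 * m)
      rw [pow_three']
      refine ((h.mul h).mul h).congr_fun fun k => ?_
      have e : m * (3 * k + 2 + 1) = 3 * (m * (k + 1)) := by ring
      have hw3 := root_pow_three hw
      have hw6 : (w ^ 2) ^ 3 = 1 := by rw [← pow_mul, mul_comm, pow_mul, hw3, one_pow]
      rw [e, pow_mul w, pow_mul (w ^ 2), hw3, hw6, one_pow, map_one, one_mul,
        show 3 * m * (k + 1) = 3 * (m * (k + 1)) by ring]
    · refine (hp r).congr_fun fun k => ?_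
      rw [prod_conj hw _ (hne k hr2), ← pow_mul]
      congr 2
      ring
  rw [hN, pow_succ (toComplex (f (3 * m))) 3]
  nth_rw 3 [hF]
  simp only [prod_range_succ, prod_range_zero, h9]
  simp
  ring

include hw in
theorem rescale_expand_three (F : ℤ⟦X⟧) :
    rescale w (toComplex (expand 3 (by norm_num) F)) = toComplex (expand 3 (by norm_num) F) := by
  ext n
  rw [coeff_rescale, toComplex, coeff_map]
  by_cases h : 3 ∣ n
  · obtain ⟨k, rfl⟩ := h
    rw [pow_mul, root_pow_three hw, one_pow, one_mul]
  · rw [coeff_expand_of_not_dvd _ _ _ h]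
    simp

include hw in
theorem rescale_sq_expand_three (F : ℤ⟦X⟧) :
    rescale (w ^ 2) (toComplex (expand 3 (by norm_num) F)) =
      toComplex (expand 3 (by norm_num) F) :=
  rescale_expand_three (w := w ^ 2) (by linear_combination hw + w * root_pow_three hw) F

include hw in
/-- The norm of `F(q^3) + c q G(q^3)`. -/
theorem cubicNorm_binomial (c : ℤ) (F G : ℤ⟦X⟧) :
    cubicNorm w (expand 3 (by norm_num) F + (c : ℤ⟦X⟧) * X * expand 3 (by norm_num) G) =
      toComplex (expand 3 (by norm_num) (F ^ 3 + (c : ℤ⟦X⟧) ^ 3 * X * G ^ 3)) := by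
  have h1 : (C w : ℂ⟦X⟧) ^ 2 + C w + 1 = 0 := by
    rw [← map_one C, ← map_pow, ← map_add, ← map_add, hw, map_zero]
  have hX : toComplex X = X := by simp [toComplex]
  rw [cubicNorm]
  simp only [map_add, map_mul, map_pow, map_intCast, rescale_expand_three hw,
    rescale_sq_expand_three hw, hX, rescale_X_complex, expand_X]
  generalize toComplex (expand 3 _ F) = A
  generalize toComplex (expand 3 _ G) = B
  generalize (C w : ℂ⟦X⟧) = t at h1
  linear_combination (A ^ 2 * (c : ℂ⟦X⟧) * X * B + A * ((c : ℂ⟦X⟧) * X * B) ^ 2 * t +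
    ((c : ℂ⟦X⟧) * X * B) ^ 3 * (t - 1)) * h1

theorem expand_injective (p : ℕ) (hp : p ≠ 0) :
    Function.Injective (expand p hp : ℤ⟦X⟧ →ₐ[ℤ] ℤ⟦X⟧) := fun F G h => by
  ext n
  rw [← coeff_expand_mul p hp F n, h, coeff_expand_mul]

theorem exists_cube_root : ∃ w : ℂ, w ^ 2 + w + 1 = 0 := by
  have h := Complex.isPrimitiveRoot_exp 3 (by norm_num)
  refine ⟨Complex.exp (2 * Real.pi * Complex.I / (3 : ℕ)), ?_⟩
  have := h.geom_sum_eq_zero (by norm_num)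
  simp [Finset.sum_range_succ] at this
  linear_combination this

theorem phi_mul : phi * f 2 = f 1 ^ 2 := by
  rw [phi, mul_assoc, mul_comm (fInv 2), f_mul_fInv two_pos, mul_one]

theorem psi_mul : psi * f 1 = f 2 ^ 2 := by
  rw [psi, mul_assoc, mul_comm (fInv 1), f_mul_fInv one_pos, mul_one]

theorem expand_nine (F : ℤ⟦X⟧) : expand 9 (by norm_num) F =
    expand 3 (by norm_num) (expand 3 (by norm_num) F) :=
  expand_mul 3 (by norm_num) 3 (by norm_num) F

theorem expand_phi_mul (p : ℕ) (hp : p ≠ 0) :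
    expand p hp phi * f (p * 2) = f (p * 1) ^ 2 := by
  have := congrArg (expand p hp) phi_mul
  rwa [map_mul, map_pow, expand_f p hp one_pos, expand_f p hp two_pos] at this

theorem expand_psi_mul (p : ℕ) (hp : p ≠ 0) :
    expand p hp psi * f (p * 1) = f (p * 2) ^ 2 := by
  have := congrArg (expand p hp) psi_mul
  rwa [map_mul, map_pow, expand_f p hp one_pos, expand_f p hp two_pos] at this

theorem toComplex_f_ne_zero {m : ℕ} (hm : 0 < m) : toComplex (f m) ≠ 0 := fun h =>
  f_ne_zero hm (toComplex_injective (by rw [h, map_zero]))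

/-- The norm of φ(-q) is computed twice: from its 3-dissection, and as φ(-q³)^4/φ(-q^9) by
`cubicNorm_f`. Both are series in q³, so q³ may be replaced by q. `psi_cubic_relation` is the same
argument for ψ. -/
theorem phi_cubic_relation :
    ((expand 3 (by norm_num) phi) ^ 3 - 8 * X * omega ^ 3) * expand 3 (by norm_num) phi =
      phi ^ 4 := by
  obtain ⟨w, hw⟩ := exists_cube_root
  apply expand_injective 3 (by norm_num)
  apply toComplex_injective
  have h1 := cubicNorm_f hw one_pos (by norm_num)
  have h2 := cubicNorm_f hw two_pos (by norm_num)
  have h3 := congrArg (cubicNorm w) phi_mul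
  rw [cubicNorm_mul, cubicNorm_pow] at h3
  have h4 := cubicNorm_binomial hw (-2) (expand 3 (by norm_num) phi) omega
  have h5 : expand 3 (by norm_num) (expand 3 (by norm_num) phi) +
      ((-2 : ℤ) : ℤ⟦X⟧) * X * expand 3 (by norm_num) omega = phi := by
    rw [← expand_nine]
    push_cast
    linear_combination -phi_three_dissection
  rw [h5] at h4
  have h6 := congrArg toComplex (expand_phi_mul 3 (by norm_num))
  have h7 := congrArg toComplex (expand_phi_mul 9 (by norm_num))
  rw [expand_nine] at h7
  have h8 : ((expand 3 (by norm_num) phi) ^ 3 - 8 * X * omega ^ 3) * expand 3 (by norm_num) phi =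
      ((expand 3 (by norm_num) phi) ^ 3 + ((-2 : ℤ) : ℤ⟦X⟧) ^ 3 * X * omega ^ 3) *
        expand 3 (by norm_num) phi := by
    push_cast
    ring
  rw [h8, map_mul, map_mul, ← h4, map_pow, map_pow]
  simp only [map_mul, map_pow] at h6 h7
  have n9 := toComplex_f_ne_zero (by norm_num : 0 < 9 * 1)
  have n18 := toComplex_f_ne_zero (by norm_num : 0 < 9 * 2)
  have n6 := toComplex_f_ne_zero (by norm_num : 0 < 3 * 2)
  generalize toComplex (expand 3 _ (expand 3 _ phi)) = p9 at *
  generalize toComplex (expand 3 _ phi) = p3 at *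
  generalize cubicNorm w phi = N at *
  apply mul_right_cancel₀ (mul_ne_zero (pow_ne_zero 4 n6) (mul_ne_zero (pow_ne_zero 2 n9) n18))
  generalize cubicNorm w (f 1) = N1 at *
  generalize cubicNorm w (f 2) = N2 at *
  generalize toComplex (f (9 * 1)) = a at *
  generalize toComplex (f (9 * 2)) = b at *
  generalize toComplex (f (3 * 1)) = c at *
  generalize toComplex (f (3 * 2)) = d at *
  have e1 : (p3 * d) ^ 4 = (c ^ 2) ^ 4 := by rw [h6]
  linear_combination (-a ^ 2 * b) * e1 + N * d ^ 4 * a ^ 2 * h7 - N * a ^ 4 * h2 +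
    a ^ 4 * b * h3 + a ^ 2 * b * (N1 * a + c ^ 4) * h1

theorem psi_cubic_relation :
    (thetaA ^ 3 + X * (expand 3 (by norm_num) psi) ^ 3) * expand 3 (by norm_num) psi =
      psi ^ 4 := by
  obtain ⟨w, hw⟩ := exists_cube_root
  apply expand_injective 3 (by norm_num)
  apply toComplex_injective
  have h1 := cubicNorm_f hw one_pos (by norm_num)
  have h2 := cubicNorm_f hw two_pos (by norm_num)
  have h3 := congrArg (cubicNorm w) psi_mul
  rw [cubicNorm_mul, cubicNorm_pow] at h3
  have h4 := cubicNorm_binomial hw 1 thetaA (expand 3 (by norm_num) psi)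
  have h5 : expand 3 (by norm_num) thetaA +
      ((1 : ℤ) : ℤ⟦X⟧) * X * expand 3 (by norm_num) (expand 3 (by norm_num) psi) = psi := by
    rw [← expand_nine]
    push_cast
    linear_combination -psi_three_dissection
  rw [h5] at h4
  have h6 := congrArg toComplex (expand_psi_mul 3 (by norm_num))
  have h7 := congrArg toComplex (expand_psi_mul 9 (by norm_num))
  rw [expand_nine] at h7
  simp only [Int.cast_one, one_pow, one_mul] at h4
  rw [map_mul, map_mul, ← h4, map_pow, map_pow]
  simp only [map_mul, map_pow] at h6 h7
  have n9 := toComplex_f_ne_zero (by norm_num : 0 < 9 * 1)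
  have n18 := toComplex_f_ne_zero (by norm_num : 0 < 9 * 2)
  have n3 := toComplex_f_ne_zero (by norm_num : 0 < 3 * 1)
  generalize toComplex (expand 3 _ (expand 3 _ psi)) = p9 at *
  generalize toComplex (expand 3 _ psi) = p3 at *
  generalize cubicNorm w psi = N at *
  apply mul_right_cancel₀ (mul_ne_zero (pow_ne_zero 4 n3) (mul_ne_zero n9 (pow_ne_zero 2 n18)))
  generalize cubicNorm w (f 1) = N1 at *
  generalize cubicNorm w (f 2) = N2 at *
  generalize toComplex (f (9 * 1)) = b at *
  generalize toComplex (f (9 * 2)) = a at *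
  generalize toComplex (f (3 * 1)) = d at *
  generalize toComplex (f (3 * 2)) = c at *
  have e1 : (p3 * d) ^ 4 = (c ^ 2) ^ 4 := by rw [h6]
  linear_combination (-a ^ 2 * b) * e1 + N * d ^ 4 * a ^ 2 * h7 - N * a ^ 4 * h1 +
    a ^ 4 * b * h3 + a ^ 2 * b * (N2 * a + c ^ 4) * h2

end CubicNorm

/-! ### Extraction of arithmetic progressions. -/

section Sections

/-- The section `∑ c(a n + r) q^n` of `∑ c(n) q^n`. -/
noncomputable def sec (a r : ℕ) : ℤ⟦X⟧ →+ ℤ⟦X⟧ where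
  toFun F := PowerSeries.mk fun n => coeff (a * n + r) F
  map_zero' := by ext; simp
  map_add' F G := by ext; simp

theorem coeff_sec (a r n : ℕ) (F : ℤ⟦X⟧) : coeff n (sec a r F) = coeff (a * n + r) F := by
  simp [sec]

theorem sec_mul_expand {a r : ℕ} (hr : r < a) (ha : a ≠ 0) (F H : ℤ⟦X⟧) :
    sec a r (F * expand a ha H) = sec a r F * H := by
  ext n
  rw [coeff_sec, coeff_mul, coeff_mul]
  symm
  -- Only second indices divisible by a contribute; the first index is then ≡ r mod a.
  refine Finset.sum_of_injOn (fun p => (a * p.1 + r, a * p.2)) ?_ ?_ ?_ ?_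
  · rintro ⟨x₁, x₂⟩ _ ⟨y₁, y₂⟩ _ h
    simpa [ha] using h
  · rintro ⟨x₁, x₂⟩ h
    simp only [mem_coe, HasAntidiagonal.mem_antidiagonal] at h ⊢
    subst h
    ring
  · rintro ⟨x₁, x₂⟩ h hx
    rw [HasAntidiagonal.mem_antidiagonal] at h
    by_cases hd : a ∣ x₂
    · obtain ⟨k, rfl⟩ := hd
      refine absurd ⟨(n - k, k), ?_, ?_⟩ hx
      · have hk : a * k < a * (n + 1) := by dsimp only at h; linarith
        have := Nat.lt_of_mul_lt_mul_left hk
        simp only [mem_coe, HasAntidiagonal.mem_antidiagonal]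
        omega
      · have hk : a * k < a * (n + 1) := by dsimp only at h; linarith
        have := Nat.lt_of_mul_lt_mul_left hk
        obtain ⟨l, rfl⟩ := Nat.exists_eq_add_of_le (by omega : k ≤ n)
        simp only [Nat.add_sub_cancel_left, Prod.mk.injEq, and_true]
        dsimp only at h
        linarith
    · rw [coeff_expand_of_not_dvd _ _ _ hd, mul_zero]
  · rintro ⟨x₁, x₂⟩ _
    simp only
    rw [coeff_sec, coeff_expand_mul]

theorem sec_X_pow {a r c : ℕ} (hr : r < a) (hc : c < a) :
    sec a r (X ^ c) = if c = r then 1 else 0 := by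
  ext n
  rw [coeff_sec, coeff_X_pow]
  split_ifs with h1 h2 h2
  · have : n = 0 := by
      subst h2
      have : a * n = 0 := by omega
      rcases Nat.mul_eq_zero.1 this with h | h
      · omega
      · exact h
    simp [this]
  · have h3 := congrArg (· % a) h1
    simp only [Nat.mul_add_mod, Nat.mod_eq_of_lt hr, Nat.mod_eq_of_lt hc] at h3
    exact absurd h3.symm h2
  · subst h2
    have : n ≠ 0 := by rintro rfl; simp at h1
    simp [coeff_one, this]
  · simp

theorem sec_X_pow_mul_expand {a r c : ℕ} (hr : r < a) (hc : c < a) (ha : a ≠ 0) (H : ℤ⟦X⟧) :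
    sec a r (X ^ c * expand a ha H) = if c = r then H else 0 := by
  rw [sec_mul_expand hr, sec_X_pow hr hc, ite_mul, one_mul, zero_mul]

theorem sec_expand {a r : ℕ} (hr : r < a) (hr0 : r ≠ 0) (ha : a ≠ 0) (H : ℤ⟦X⟧) :
    sec a r (expand a ha H) = 0 := by
  have := sec_X_pow_mul_expand hr (Nat.pos_of_ne_zero ha) ha H
  simpa [hr0.symm] using this

theorem sec_natCast_mul (a r n : ℕ) (F : ℤ⟦X⟧) : sec a r (n * F) = n * sec a r F := by
  rw [← nsmul_eq_mul, map_nsmul, nsmul_eq_mul]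

theorem sec_three {r : ℕ} (hr : r < 3) (A B C : ℤ⟦X⟧) :
    sec 3 r (expand 3 (by norm_num) A + X * expand 3 (by norm_num) B +
      X ^ 2 * expand 3 (by norm_num) C) = if r = 0 then A else if r = 1 then B else C := by
  have h0 := sec_X_pow_mul_expand (c := 0) hr (by norm_num) (by norm_num) A
  have h1 := sec_X_pow_mul_expand (c := 1) hr (by norm_num) (by norm_num) B
  have h2 := sec_X_pow_mul_expand (c := 2) hr (by norm_num) (by norm_num) C
  rw [pow_zero, one_mul] at h0
  rw [pow_one] at h1
  rw [map_add, map_add, h0, h1, h2]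
  interval_cases r <;> simp

theorem sec_four {r : ℕ} (hr : r < 4) (A B C D : ℤ⟦X⟧) :
    sec 4 r (expand 4 (by norm_num) A + X * expand 4 (by norm_num) B +
      X ^ 2 * expand 4 (by norm_num) C + X ^ 3 * expand 4 (by norm_num) D) =
      if r = 0 then A else if r = 1 then B else if r = 2 then C else D := by
  have h0 := sec_X_pow_mul_expand (c := 0) hr (by norm_num) (by norm_num) A
  have h1 := sec_X_pow_mul_expand (c := 1) hr (by norm_num) (by norm_num) B
  have h2 := sec_X_pow_mul_expand (c := 2) hr (by norm_num) (by norm_num) C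
  have h3 := sec_X_pow_mul_expand (c := 3) hr (by norm_num) (by norm_num) D
  rw [pow_zero, one_mul] at h0
  rw [pow_one] at h1
  rw [map_add, map_add, map_add, h0, h1, h2, h3]
  interval_cases r <;> simp

end Sections

/-! ### Congruences between power series. -/

section Reduction

/-- Reduction of integer power series modulo `n`. -/
noncomputable def red (n : ℕ) : ℤ⟦X⟧ →+* ℤ⟦X⟧ ⧸ Ideal.span {(n : ℤ⟦X⟧)} :=
  Ideal.Quotient.mk _

theorem red_eq_red {n : ℕ} {F G : ℤ⟦X⟧} : red n F = red n G ↔ (n : ℤ⟦X⟧) ∣ F - G := by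
  rw [red, Ideal.Quotient.eq, Ideal.mem_span_singleton]

theorem red_eq_zero {n : ℕ} {F : ℤ⟦X⟧} : red n F = 0 ↔ (n : ℤ⟦X⟧) ∣ F := by
  rw [← map_zero (red n), red_eq_red, sub_zero]

theorem natCast_red (n : ℕ) : ((n : ℕ) : ℤ⟦X⟧ ⧸ Ideal.span {(n : ℤ⟦X⟧)}) = 0 := by
  rw [← map_natCast (red n), red_eq_zero]

theorem red_sec {n : ℕ} {F G : ℤ⟦X⟧} (h : red n F = red n G) (a r : ℕ) :
    red n (sec a r F) = red n (sec a r G) := by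
  rw [red_eq_red] at h ⊢
  obtain ⟨H, hH⟩ := h
  rw [← map_sub, hH, sec_natCast_mul]
  exact dvd_mul_right _ _

theorem red_natCast_mul {n : ℕ} {F G : ℤ⟦X⟧} (k : ℕ) (h : red n F = red n G) :
    red (k * n) (k * F) = red (k * n) (k * G) := by
  rw [red_eq_red] at h ⊢
  rw [← mul_sub, Nat.cast_mul]
  exact mul_dvd_mul_left _ h

theorem red_of_dvd {m n : ℕ} {F G : ℤ⟦X⟧} (h : red n F = red n G) (hmn : m ∣ n) :
    red m F = red m G := by
  rw [red_eq_red] at h ⊢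
  exact (Nat.cast_dvd_cast hmn).trans h

theorem red_expand {n : ℕ} {F G : ℤ⟦X⟧} (h : red n F = red n G) (p : ℕ) (hp : p ≠ 0) :
    red n (expand p hp F) = red n (expand p hp G) := by
  rw [red_eq_red] at h ⊢
  obtain ⟨H, hH⟩ := h
  rw [← map_sub, hH, map_mul, map_natCast]
  exact dvd_mul_right _ _

theorem dvd_coeff_of_red_eq_zero {n : ℕ} {F : ℤ⟦X⟧} (h : red n F = 0) (k : ℕ) :
    (n : ℤ) ∣ coeff k F := by
  obtain ⟨G, rfl⟩ := red_eq_zero.1 h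
  rw [← nsmul_eq_mul, map_nsmul, nsmul_eq_mul]
  exact dvd_mul_right _ _

theorem red_pow_of_red {p : ℕ} {F G : ℤ⟦X⟧} (h : red p F = red p G) (k : ℕ) :
    red (p ^ (k + 1)) (F ^ p ^ k) = red (p ^ (k + 1)) (G ^ p ^ k) := by
  rw [red_eq_red] at h ⊢
  simpa using dvd_sub_pow_of_dvd_sub h k

/-- Over `ZMod p` Frobenius fixes the coefficients, so F^p is F(q^p). -/
theorem red_pow_prime {p : ℕ} (hp : p.Prime) (F : ℤ⟦X⟧) :
    red p (F ^ p) = red p (expand p hp.ne_zero F) := by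
  have : Fact p.Prime := ⟨hp⟩
  rw [red_eq_red]
  have h1 : PowerSeries.map (Int.castRingHom (ZMod p)) (F ^ p - expand p hp.ne_zero F) = 0 := by
    rw [map_sub, map_pow, map_expand, sub_eq_zero]
    have h2 : expand p hp.ne_zero (PowerSeries.map (Int.castRingHom (ZMod p)) F) =
        PowerSeries.map (Int.castRingHom (ZMod p)) F ^ p := by
      have := MvPowerSeries.map_frobenius_expand p hp.ne_zero
        (f := PowerSeries.map (Int.castRingHom (ZMod p)) F)
      rw [ZMod.frobenius_zmod] at this
      simpa [expand] using this
    rw [h2]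
  have h3 : ∀ n, ∃ c : ℤ, coeff n (F ^ p - expand p hp.ne_zero F) = p * c := fun n => by
    have := congrArg (coeff n) h1
    rw [coeff_map, map_zero] at this
    exact (ZMod.intCast_zmod_eq_zero_iff_dvd _ p).1 this
  choose c hc using h3
  refine ⟨PowerSeries.mk c, ?_⟩
  ext n
  rw [hc, ← nsmul_eq_mul (p : ℕ) (PowerSeries.mk c), map_nsmul, coeff_mk, nsmul_eq_mul]

/-- `F(q)^{p^{k+1}} ≡ F(q^p)^{p^k} (mod p^{k+1})`. -/
theorem red_pow_prime_pow {p : ℕ} (hp : p.Prime) (F : ℤ⟦X⟧) (k : ℕ) {m n : ℕ}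
    (hn : p ^ (k + 1) = n) (hm : p ^ k = m) :
    red n (F ^ n) = red n (expand p hp.ne_zero F ^ m) := by
  subst hn hm
  rw [show F ^ p ^ (k + 1) = (F ^ p) ^ p ^ k by rw [← pow_mul, ← pow_succ']]
  exact red_pow_of_red (red_pow_prime hp F) k

end Reduction

/-! ### The generating function in terms of 1/φ(-q). -/

theorem f_two : f 2 = expand 2 (by norm_num) (f 1) := (expand_f 2 _ one_pos).symm

theorem fInv_two : fInv 2 = expand 2 (by norm_num) (fInv 1) := (expand_fInv 2 _ one_pos).symm

theorem fInv_four : fInv 4 = expand 4 (by norm_num) (fInv 1) := (expand_fInv 4 _ one_pos).symm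

theorem genFun_eq (k : ℕ) : genFun k = f 2 ^ k * fInv 1 ^ (3 * k + 1) := rfl

/-- The inverse of `phi`. -/
noncomputable def phiInv : ℤ⟦X⟧ := f 2 * fInv 1 ^ 2

theorem phi_mul_phiInv : phi * phiInv = 1 := by
  have h1 := f_mul_fInv one_pos
  have h2 := f_mul_fInv two_pos
  rw [phi, phiInv]
  linear_combination (f 1 * fInv 1) ^ 2 * h2 + (f 1 * fInv 1 + 1) * h1

theorem genFun_eq_phiInv (k : ℕ) : genFun k = phiInv ^ k * fInv 1 ^ (k + 1) := by
  rw [genFun_eq, phiInv]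
  ring

theorem fInv_one_sq : fInv 1 ^ 2 = phiInv * fInv 2 := by
  have h2 := f_mul_fInv two_pos
  rw [phiInv]
  linear_combination (-fInv 1 ^ 2) * h2

/-! ### Congruences modulo 2, 4 and 8. -/

section PowersOfTwo

theorem red_two_phi : red 2 phi = red 2 1 := by
  have h : red 2 (f 1 ^ 2) = red 2 (f 2) := by rw [f_two]; exact red_pow_prime Nat.prime_two _
  rw [phi, map_mul, h, ← map_mul, f_mul_fInv two_pos]

theorem red_two_phiInv : red 2 phiInv = red 2 1 := by
  have h := congrArg (red 2) phi_mul_phiInv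
  rwa [map_mul, red_two_phi, map_one, one_mul] at h

theorem red_four_sq {F : ℤ⟦X⟧} (h : red 2 F = red 2 1) : red 4 (F ^ 2) = red 4 1 := by
  simpa using red_pow_of_red h 1

theorem red_eight_pow_four {F : ℤ⟦X⟧} (h : red 2 F = red 2 1) : red 8 (F ^ 4) = red 8 1 := by
  simpa using red_pow_of_red h 2

/-- φ^{-(4i+3)} = φ·(φ^{-4})^{i+1}, and φ^{-4} ≡ 1 mod 8. -/
theorem red_eight_genFun (i : ℕ) :
    red 8 (genFun (4 * i + 3)) = red 8 (phi * (fInv 1 ^ 4) ^ (i + 1)) := by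
  have h := red_eight_pow_four red_two_phiInv
  have e : genFun (4 * i + 3) = phi * (phiInv ^ 4) ^ (i + 1) * (fInv 1 ^ 4) ^ (i + 1) := by
    rw [genFun_eq_phiInv]
    have : phi * (phiInv ^ 4) ^ (i + 1) = phiInv ^ (4 * i + 3) := by
      linear_combination phiInv ^ (4 * i + 3) * phi_mul_phiInv
    rw [this]
    ring
  rw [e, map_mul, map_mul, map_pow, h, map_one, one_pow, mul_one, ← map_mul]

theorem expand_two_expand_two (F : ℤ⟦X⟧) :
    expand 2 (by norm_num) (expand 2 (by norm_num) F) = expand 4 (by norm_num) F :=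
  (expand_mul 2 (by norm_num) 2 (by norm_num) F).symm

theorem expand_four_expand_two (F : ℤ⟦X⟧) :
    expand 4 (by norm_num) (expand 2 (by norm_num) F) = expand 8 (by norm_num) F :=
  (expand_mul 4 (by norm_num) 2 (by norm_num) F).symm

theorem expand_two_expand_four (F : ℤ⟦X⟧) :
    expand 2 (by norm_num) (expand 4 (by norm_num) F) =
      expand 4 (by norm_num) (expand 2 (by norm_num) F) := by
  rw [← expand_two_expand_two, ← expand_two_expand_two]

theorem expand_two_expand_eight (F : ℤ⟦X⟧) :
    expand 2 (by norm_num) (expand 8 (by norm_num) F) =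
      expand 4 (by norm_num) (expand 4 (by norm_num) F) := by
  rw [← expand_four_expand_two, expand_two_expand_four, expand_two_expand_two]

theorem red_two_pow_two (F : ℤ⟦X⟧) : red 2 (F ^ 2) = red 2 (expand 2 (by norm_num) F) :=
  red_pow_prime Nat.prime_two F

theorem red_two_pow_four (F : ℤ⟦X⟧) : red 2 (F ^ 4) = red 2 (expand 4 (by norm_num) F) := by
  rw [show F ^ 4 = (F ^ 2) ^ 2 by ring, map_pow, red_two_pow_two, ← map_pow, red_two_pow_two,
    expand_two_expand_two]

/-- `φ(-q^2)`. -/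
noncomputable def phiTwo : ℤ⟦X⟧ := expand 2 (by norm_num) phi

theorem phi_sections : phi = expand 4 (by norm_num) phiPos -
    2 * X * expand 4 (by norm_num) (expand 2 (by norm_num) psi) := by
  rw [expand_four_expand_two]
  exact phi_four_dissection

theorem phiTwo_sections : phiTwo = expand 4 (by norm_num) (expand 2 (by norm_num) phiPos) -
    2 * X ^ 2 * expand 4 (by norm_num) (expand 4 (by norm_num) psi) := by
  have h := congrArg (expand 2 (by norm_num)) phi_four_dissection
  rw [map_sub, map_mul, map_mul, expand_X, map_ofNat, expand_two_expand_four,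
    expand_two_expand_eight] at h
  exact h

theorem red_two_expand_phi {p : ℕ} (hp : p ≠ 0) : red 2 (expand p hp phi) = red 2 1 := by
  have := red_expand red_two_phi p hp
  rwa [map_one] at this

theorem red_two_expand_phiInv {p : ℕ} (hp : p ≠ 0) : red 2 (expand p hp phiInv) = red 2 1 := by
  have := red_expand red_two_phiInv p hp
  rwa [map_one] at this

theorem phiTwo_mul : phiTwo * expand 2 (by norm_num) phiInv = 1 := by
  have := congrArg (expand 2 (by norm_num)) phi_mul_phiInv
  rwa [map_mul, map_one] at this

theorem expand_fInv_one_sq : expand 2 (by norm_num) (fInv 1) ^ 2 =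
    expand 2 (by norm_num) phiInv * expand 4 (by norm_num) (fInv 1) := by
  rw [← map_pow, fInv_one_sq, map_mul, fInv_two, expand_two_expand_two]

/-- f_1^{-4} ≡ f_2^{-2} = φ(-q²)^{-1} f_4^{-1}, and φ(-q²) is its own inverse mod 4. -/
theorem red_four_fInv_pow : red 4 (fInv 1 ^ 4) =
    red 4 (phiTwo * expand 4 (by norm_num) (fInv 1)) := by
  have h1 := red_pow_prime_pow Nat.prime_two (fInv 1) 1 (n := 4) (m := 2) rfl rfl
  rw [expand_fInv_one_sq] at h1
  have h2 := red_four_sq (red_two_expand_phiInv (p := 2) (by norm_num))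
  have h3 : red 4 (expand 2 (by norm_num) phiInv) = red 4 phiTwo := by
    have := congrArg (fun F => red 4 (F * expand 2 (by norm_num) phiInv)) phiTwo_mul
    simp only [one_mul, mul_assoc, ← pow_two] at this
    rw [map_mul, h2, map_one, mul_one] at this
    exact this.symm
  rw [h1, map_mul, h3, map_mul]

theorem red_four_genFun (i : ℕ) : red 4 (genFun (4 * i + 3)) =
    red 4 (phi * phiTwo ^ (i + 1) * expand 4 (by norm_num) (fInv 1 ^ (i + 1))) := by
  have h := red_of_dvd (red_eight_genFun i) (by norm_num : 4 ∣ 8)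
  rw [h, map_mul, map_pow, red_four_fInv_pow]
  simp only [map_mul, map_pow]
  ring

theorem red_two_genFun (i : ℕ) : red 2 (genFun (4 * i + 3)) =
    red 2 (expand 4 (by norm_num) (fInv 1 ^ (i + 1))) := by
  have h := red_of_dvd (red_eight_genFun i) (by norm_num : 2 ∣ 8)
  rw [h, map_mul, map_pow, red_two_phi, red_two_pow_four, map_one, one_mul, map_pow, map_pow]

theorem red_two_sec_four_two (i : ℕ) : red 2 (sec 4 2 (genFun (4 * i + 3))) = 0 := by
  rw [red_sec (red_two_genFun i), sec_expand (by norm_num) (by norm_num), map_zero]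

theorem phiTwo_pow_sections (k : ℕ) : ∃ U V : ℤ⟦X⟧, red 4 (phiTwo ^ k) =
    red 4 (expand 4 (by norm_num) U + 2 * X ^ 2 * expand 4 (by norm_num) V) := by
  induction k with
  | zero => exact ⟨1, 0, by simp⟩
  | succ k ih =>
    obtain ⟨U, V, h⟩ := ih
    rw [pow_succ, map_mul, h, ← map_mul, phiTwo_sections]
    generalize expand 2 _ phiPos = A
    generalize expand 4 _ psi = B
    refine ⟨U * A, V * A - U * B, ?_⟩
    rw [red_eq_red]
    refine ⟨-X ^ 4 * expand 4 (by norm_num) V * expand 4 (by norm_num) B, ?_⟩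
    simp only [map_mul, map_sub]
    push_cast
    ring

/-- Class 3 arises only from the -2q part of φ(-q) times the 2q² part of a power of φ(-q²). -/
theorem red_four_sec_four_three (i : ℕ) : red 4 (sec 4 3 (genFun (4 * i + 3))) = 0 := by
  rw [red_sec (red_four_genFun i), sec_mul_expand (by norm_num), map_mul]
  obtain ⟨U, V, h⟩ := phiTwo_pow_sections (i + 1)
  have h2 : red 4 (phi * phiTwo ^ (i + 1)) = red 4 (expand 4 (by norm_num) (phiPos * U) +
      X * expand 4 (by norm_num) (-2 * expand 2 (by norm_num) psi * U) +
      X ^ 2 * expand 4 (by norm_num) (2 * phiPos * V) +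
      X ^ 3 * expand 4 (by norm_num) (-4 * expand 2 (by norm_num) psi * V)) := by
    rw [map_mul, h, ← map_mul, phi_sections]
    congr 1
    simp only [map_mul, map_neg, map_ofNat]
    ring
  rw [red_sec h2, sec_four (by norm_num)]
  simp only [OfNat.ofNat_ne_zero, OfNat.ofNat_ne_one, if_false, show ¬ (3 = 2) by norm_num]
  have h4 := natCast_red 4
  push_cast at h4
  rw [map_mul, map_mul, map_neg, map_ofNat, h4]
  ring

theorem red_four_genFun_even (i : ℕ) : red 4 (genFun (8 * i + 7)) =
    red 4 (phi * expand 4 (by norm_num) (fInv 1 ^ (2 * (i + 1)))) := by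
  have h := red_four_genFun (2 * i + 1)
  have h2 := red_four_sq (red_two_expand_phi (p := 2) (by norm_num))
  rw [show 4 * (2 * i + 1) + 3 = 8 * i + 7 by ring,
    show 2 * i + 1 + 1 = 2 * (i + 1) by ring, pow_mul phiTwo] at h
  rw [h, map_mul, map_mul, map_pow, phiTwo, h2, map_one, one_pow, mul_one, ← map_mul]

theorem sec_phi_one : sec 4 1 phi = ((2 : ℕ) : ℤ⟦X⟧) * -expand 2 (by norm_num) psi := by
  have h : phi = expand 4 (by norm_num) phiPos +
      X * expand 4 (by norm_num) (((2 : ℕ) : ℤ⟦X⟧) * -expand 2 (by norm_num) psi) +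
      X ^ 2 * expand 4 (by norm_num) 0 + X ^ 3 * expand 4 (by norm_num) 0 := by
    rw [phi_sections]
    simp only [map_mul, map_neg, map_natCast, map_zero]
    push_cast
    ring
  rw [h, sec_four (by norm_num)]
  simp

theorem sec_phi_two : sec 4 2 phi = 0 := by
  have h : phi = expand 4 (by norm_num) phiPos +
      X * expand 4 (by norm_num) (((2 : ℕ) : ℤ⟦X⟧) * -expand 2 (by norm_num) psi) +
      X ^ 2 * expand 4 (by norm_num) 0 + X ^ 3 * expand 4 (by norm_num) 0 := by
    rw [phi_sections]
    simp only [map_mul, map_neg, map_natCast, map_zero]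
    push_cast
    ring
  rw [h, sec_four (by norm_num)]
  simp

theorem red_four_sec_four_two (i : ℕ) : red 4 (sec 4 2 (genFun (8 * i + 7))) = 0 := by
  rw [red_sec (red_four_genFun_even i), sec_mul_expand (by norm_num), sec_phi_two]
  simp

theorem red_four_sec_four_one (i : ℕ) : red 4 (sec 4 1 (genFun (8 * i + 7))) =
    red 4 ((2 : ℕ) * (-expand 2 (by norm_num) psi * fInv 1 ^ (2 * (i + 1)))) := by
  rw [red_sec (red_four_genFun_even i), sec_mul_expand (by norm_num), sec_phi_one, mul_assoc]

theorem red_four_sec_sec_of_red_two {F H : ℤ⟦X⟧} {a r : ℕ}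
    (hF : red 4 F = red 4 ((2 : ℕ) * H)) (hH : red 2 (sec a r H) = 0) :
    red 4 (sec a r F) = 0 := by
  rw [red_sec hF, sec_natCast_mul]
  have := red_natCast_mul 2 (hH.trans (map_zero (red 2)).symm)
  simpa using this

/-- The 4n+1 section is already twice a series, so parity suffices, and mod 2 that series depends
only on q². -/
theorem red_four_sec_two_one (i : ℕ) :
    red 4 (sec 2 1 (sec 4 1 (genFun (8 * i + 7)))) = 0 := by
  refine red_four_sec_sec_of_red_two (red_four_sec_four_one i) ?_
  have h : red 2 (-expand 2 (by norm_num) psi * fInv 1 ^ (2 * (i + 1))) =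
      red 2 (expand 2 (by norm_num) (-psi * fInv 1 ^ (i + 1))) := by
    rw [map_mul, pow_mul, map_pow, red_two_pow_two, ← map_pow, ← map_mul]
    simp only [map_mul, map_pow, map_neg]
  rw [red_sec h, sec_expand (by norm_num) (by norm_num), map_zero]

/-- For this k the halved series is, mod 2, f_4²/f_2² times f_1^{-4i}; since f_2^{-2} ≡ f_4^{-1}, it
depends only on q^4. -/
theorem red_four_sec_four_two_sec (i : ℕ) :
    red 4 (sec 4 2 (sec 4 1 (genFun (16 * i + 7)))) = 0 := by
  have h1 := red_four_sec_four_one (2 * i)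
  rw [show 8 * (2 * i) + 7 = 16 * i + 7 by ring] at h1
  refine red_four_sec_sec_of_red_two h1 ?_
  have h : red 2 (-expand 2 (by norm_num) psi * fInv 1 ^ (2 * (2 * i + 1))) =
      red 2 (expand 4 (by norm_num) (-f 1 ^ 2 * fInv 1 * fInv 1 ^ i)) := by
    have h2 := red_two_pow_two (fInv 1)
    have h4 := red_two_pow_four (fInv 1)
    have h3 := red_two_pow_two (fInv 2)
    rw [fInv_two, expand_two_expand_two] at h3
    rw [show fInv 1 ^ (2 * (2 * i + 1)) = (fInv 1 ^ 2) * (fInv 1 ^ 4) ^ i by ring, map_mul,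
      map_mul _ (fInv 1 ^ 2), map_pow _ (fInv 1 ^ 4), h2, h4, psi, map_mul, map_pow, f_two, expand_two_expand_two]
    simp only [map_mul, map_neg, map_pow] at h3 ⊢
    rw [← h3]
    ring
  rw [red_sec h, sec_expand (by norm_num) (by norm_num), map_zero]

theorem red_eight_fInv_pow : red 8 (fInv 1 ^ 8) =
    red 8 (phiTwo ^ 2 * expand 4 (by norm_num) (fInv 1 ^ 2)) := by
  have h1 := red_pow_prime_pow Nat.prime_two (fInv 1) 2 (n := 8) (m := 4) rfl rfl
  have h2 := red_eight_pow_four (red_two_expand_phiInv (p := 2) (by norm_num))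
  have h3 : red 8 (expand 2 (by norm_num) phiInv ^ 2) = red 8 (phiTwo ^ 2) := by
    have e : phiTwo ^ 2 * expand 2 (by norm_num) phiInv ^ 4 =
        expand 2 (by norm_num) phiInv ^ 2 := by
      linear_combination (expand 2 (by norm_num) phiInv ^ 2) *
        (phiTwo * expand 2 (by norm_num) phiInv + 1) * phiTwo_mul
    rw [← e, map_mul, h2, map_one, mul_one]
  have e2 : expand 2 (by norm_num) (fInv 1) ^ 4 =
      expand 2 (by norm_num) phiInv ^ 2 * expand 4 (by norm_num) (fInv 1) ^ 2 := by
    linear_combination (expand 2 (by norm_num) (fInv 1) ^ 2 +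
      expand 2 (by norm_num) phiInv * expand 4 (by norm_num) (fInv 1)) * expand_fInv_one_sq
  rw [e2] at h1
  rw [h1, map_mul, h3, ← map_mul, map_pow]

theorem red_eight_genFun_even (i : ℕ) : red 8 (genFun (8 * i + 7)) =
    red 8 (phi * (phiTwo ^ 2) ^ (i + 1) * expand 4 (by norm_num) (fInv 1 ^ (2 * (i + 1)))) := by
  have h := red_eight_genFun (2 * i + 1)
  rw [show 4 * (2 * i + 1) + 3 = 8 * i + 7 by ring] at h
  rw [h, show (fInv 1 ^ 4) ^ (2 * i + 1 + 1) = (fInv 1 ^ 8) ^ (i + 1) by ring, map_mul, map_pow,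
    red_eight_fInv_pow]
  simp only [map_mul, map_pow]
  ring

/-- The part of `φ(-q^2)^2` with exponents divisible by `4`, in the variable `q^4`. -/
noncomputable def phiTwoSqZero : ℤ⟦X⟧ :=
  expand 2 (by norm_num) phiPos ^ 2 + 4 * X * expand 4 (by norm_num) psi ^ 2

theorem phiTwo_sq_sections : phiTwo ^ 2 = expand 4 (by norm_num) phiTwoSqZero +
    4 * X ^ 2 * expand 4 (by norm_num)
      (-expand 2 (by norm_num) phiPos * expand 4 (by norm_num) psi) := by
  rw [phiTwo_sections, phiTwoSqZero]
  generalize expand 2 _ phiPos = A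
  generalize expand 4 _ psi = B
  simp only [map_mul, map_add, map_neg, map_pow, map_ofNat, expand_X]
  ring

theorem phiTwo_sq_pow_sections (k : ℕ) : ∃ U V : ℤ⟦X⟧, red 8 ((phiTwo ^ 2) ^ k) =
    red 8 (expand 4 (by norm_num) U + 4 * X ^ 2 * expand 4 (by norm_num) V) := by
  induction k with
  | zero => exact ⟨1, 0, by simp⟩
  | succ k ih =>
    obtain ⟨U, V, h⟩ := ih
    rw [pow_succ, map_mul, h, ← map_mul, phiTwo_sq_sections]
    generalize phiTwoSqZero = A
    generalize (-expand 2 _ phiPos * expand 4 _ psi) = B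
    refine ⟨U * A, V * A + U * B, ?_⟩
    rw [red_eq_red]
    refine ⟨2 * X ^ 4 * expand 4 (by norm_num) V * expand 4 (by norm_num) B, ?_⟩
    simp only [map_mul, map_add]
    push_cast
    ring

theorem red_eight_sec_four_three (i : ℕ) : red 8 (sec 4 3 (genFun (8 * i + 7))) = 0 := by
  rw [red_sec (red_eight_genFun_even i), sec_mul_expand (by norm_num), map_mul]
  obtain ⟨U, V, h⟩ := phiTwo_sq_pow_sections (i + 1)
  have h2 : red 8 (phi * (phiTwo ^ 2) ^ (i + 1)) = red 8 (expand 4 (by norm_num) (phiPos * U) +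
      X * expand 4 (by norm_num) (-2 * expand 2 (by norm_num) psi * U) +
      X ^ 2 * expand 4 (by norm_num) (4 * phiPos * V) +
      X ^ 3 * expand 4 (by norm_num) (-8 * expand 2 (by norm_num) psi * V)) := by
    rw [map_mul, h, ← map_mul, phi_sections]
    congr 1
    simp only [map_mul, map_neg, map_ofNat]
    ring
  rw [red_sec h2, sec_four (by norm_num)]
  simp only [OfNat.ofNat_ne_zero, OfNat.ofNat_ne_one, if_false, show ¬ (3 = 2) by norm_num]
  have h8 := natCast_red 8
  push_cast at h8
  rw [map_mul, map_mul, map_neg, map_ofNat, h8]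
  ring

theorem phiPos_mul_phi : phiPos * phi = expand 2 (by norm_num) (phi ^ 2) := by
  have h1 := f_mul_fInv one_pos
  have h2 := f_mul_fInv two_pos
  rw [map_pow, phi, phiPos, map_mul, map_pow, ← f_two, fInv_two, expand_two_expand_two,
    ← fInv_two, ← fInv_four]
  linear_combination (f 2 ^ 4 * fInv 4 ^ 2) * ((f 1 * fInv 1) ^ 2 * h2 + (f 1 * fInv 1 + 1) * h1)

/-- Multiplying the dissections of φ(q) and φ(-q) gives φ(q)φ(-q) = φ(-q²)² as a difference of
squares; then q² is replaced by q. -/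
theorem phi_sq : phi ^ 2 =
    expand 2 (by norm_num) phiPos ^ 2 - 4 * X * expand 4 (by norm_num) psi ^ 2 := by
  apply expand_injective 2 (by norm_num)
  have h1 := phi_four_dissection
  have h2 := phiPos_four_dissection
  have h3 : expand 2 (by norm_num) (expand 4 (by norm_num) psi) = expand 8 (by norm_num) psi :=
    (expand_mul 2 (by norm_num) 4 (by norm_num) psi).symm
  rw [← phiPos_mul_phi]
  simp only [map_sub, map_mul, map_pow, map_ofNat, expand_X, expand_two_expand_two, h3]
  nth_rw 1 [h2]
  rw [h1]
  ring

theorem red_eight_phiTwoSqZero : red 8 phiTwoSqZero = red 8 (phi ^ 2) := by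
  rw [red_eq_red, phi_sq, phiTwoSqZero]
  refine ⟨X * expand 4 (by norm_num) psi ^ 2, ?_⟩
  push_cast
  ring

/-- The step 32 makes the surplus power of φ(-q²) a power of φ(-q²)^4 ≡ 1 mod 8. The remaining
φ(-q²)² has zero section ≡ φ(-q)² mod 8, so the result collapses to f_2³/f_4² times f_1^{-8i}, a
series in q² mod 8. -/
theorem red_eight_sec_four_zero (i : ℕ) : red 8 (sec 4 0 (genFun (32 * i + 7))) =
    red 8 (phiPos * phi ^ 2 * fInv 1 ^ 2 * (fInv 1 ^ 8) ^ i) := by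
  have h := red_eight_genFun_even (4 * i)
  rw [show 8 * (4 * i) + 7 = 32 * i + 7 by ring] at h
  have h2 := red_eight_pow_four (red_two_expand_phi (p := 2) (by norm_num))
  have h3 : red 8 (phi * (phiTwo ^ 2) ^ (4 * i + 1)) = red 8 (phi * phiTwo ^ 2) := by
    rw [show phi * (phiTwo ^ 2) ^ (4 * i + 1) = phi * phiTwo ^ 2 * (phiTwo ^ 4) ^ (2 * i) by ring,
      map_mul, map_pow _ (phiTwo ^ 4), phiTwo, h2, map_one, one_pow, mul_one]
  have h4 : phi * phiTwo ^ 2 = expand 4 (by norm_num) (phiPos * phiTwoSqZero) +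
      X * expand 4 (by norm_num) (-2 * expand 2 (by norm_num) psi * phiTwoSqZero) +
      X ^ 2 * expand 4 (by norm_num)
        (4 * phiPos * (-expand 2 (by norm_num) phiPos * expand 4 (by norm_num) psi)) +
      X ^ 3 * expand 4 (by norm_num) (-8 * expand 2 (by norm_num) psi *
        (-expand 2 (by norm_num) phiPos * expand 4 (by norm_num) psi)) := by
    rw [phi_sections, phiTwo_sq_sections]
    simp only [map_mul, map_neg, map_ofNat]
    ring
  have e : phiPos * phi ^ 2 * fInv 1 ^ (2 * (4 * i + 1)) =
      phiPos * phi ^ 2 * fInv 1 ^ 2 * (fInv 1 ^ 8) ^ i := by ring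
  rw [red_sec h, sec_mul_expand (by norm_num), map_mul, red_sec h3, h4, sec_four (by norm_num),
    if_pos rfl, map_mul, red_eight_phiTwoSqZero, ← map_mul, ← map_mul, e]

theorem phiPos_mul_phi_sq_mul : phiPos * phi ^ 2 * fInv 1 ^ 2 = f 2 ^ 3 * fInv 4 ^ 2 := by
  have key : ∀ {R : Type} [CommRing R] (x y x' y' z : R), x * x' = 1 → y * y' = 1 →
      y ^ 5 * x' ^ 2 * z ^ 2 * (x ^ 2 * y') ^ 2 * x' ^ 2 = y ^ 3 * z ^ 2 := by
    intro R _ x y x' y' z h1 h2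
    have e1 : (x * x') ^ 4 = 1 := by rw [h1, one_pow]
    have e2 : (y * y') ^ 2 = 1 := by rw [h2, one_pow]
    linear_combination (y ^ 3 * z ^ 2) * ((x * x') ^ 4 * e2 + e1)
  exact key _ _ _ _ _ (f_mul_fInv one_pos) (f_mul_fInv two_pos)

theorem red_eight_sec_two_one (i : ℕ) :
    red 8 (sec 2 1 (sec 4 0 (genFun (32 * i + 7)))) = 0 := by
  have h1 := red_pow_prime_pow Nat.prime_two (fInv 1) 2 (n := 8) (m := 4) rfl rfl
  have h : red 8 (phiPos * phi ^ 2 * fInv 1 ^ 2 * (fInv 1 ^ 8) ^ i) =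
      red 8 (expand 2 (by norm_num) (f 1 ^ 3 * fInv 2 ^ 2 * (fInv 1 ^ 4) ^ i)) := by
    rw [phiPos_mul_phi_sq_mul, map_mul, map_pow _ (fInv 1 ^ 8), h1]
    simp only [map_mul, map_pow, f_two, fInv_two, fInv_four, expand_two_expand_two]
  rw [red_sec (red_eight_sec_four_zero i), red_sec h, sec_expand (by norm_num) (by norm_num),
    map_zero]

end PowersOfTwo

/-! ### Congruences modulo 9, 27 and 243. -/

section PowersOfThree

/-- The substitution `q ↦ q^3`. -/
noncomputable abbrev expandThree : ℤ⟦X⟧ →ₐ[ℤ] ℤ⟦X⟧ := expand 3 (by norm_num)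

/-- `φ(-q^3)`. -/
noncomputable abbrev phiThree : ℤ⟦X⟧ := expandThree phi

/-- `ψ(q^3)`. -/
noncomputable abbrev psiThree : ℤ⟦X⟧ := expandThree psi

/-- The component of `f_1^3` with exponents divisible by `3`, in the variable `q^3`. -/
noncomputable def cubeZero : ℤ⟦X⟧ := phiThree ^ 2 * thetaA + 4 * X * omega ^ 2 * psiThree

/-- `f_3^3 = φ(-q^3)^2 ψ(q^3)`. -/
noncomputable def cubeOne : ℤ⟦X⟧ := phiThree ^ 2 * psiThree

/-- `f_1^{12} / f_3^3`. -/
noncomputable def cubeNorm : ℤ⟦X⟧ := cubeZero ^ 3 - 27 * X * cubeOne ^ 3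

/-- `1 / f_1^3`. -/
noncomputable def cubeInv : ℤ⟦X⟧ := fInv 1 ^ 3

theorem phi_three : phi = expandThree phiThree - 2 * X * expandThree omega := by
  rw [← expand_nine]
  exact phi_three_dissection

theorem psi_three : psi = expandThree thetaA + X * expandThree psiThree := by
  rw [← expand_nine]
  exact psi_three_dissection

theorem phiThree_eq : phiThree = f 3 ^ 2 * fInv 6 := by
  rw [phiThree, expandThree, phi, map_mul, map_pow, expand_f _ _ one_pos, expand_fInv _ _ two_pos,
    Nat.mul_one, show 3 * 2 = 6 from rfl]

theorem psiThree_eq : psiThree = f 6 ^ 2 * fInv 3 := by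
  rw [psiThree, expandThree, psi, map_mul, map_pow, expand_f _ _ two_pos, expand_fInv _ _ one_pos,
    Nat.mul_one, show 3 * 2 = 6 from rfl]

theorem thetaA_mul_omega : thetaA * omega = phiThree * psiThree := by
  have key : ∀ {R : Type} [CommRing R] (x y z t x' y' z' t' : R), x * x' = 1 → y * y' = 1 →
      y * z ^ 2 * x' * t' * (x * t ^ 2 * y' * z') = z ^ 2 * t' * (t ^ 2 * z') := by
    intro R _ x y z t x' y' z' t' h1 h2
    linear_combination (z ^ 2 * t' * (t ^ 2 * z')) * (x * x' * h2 + h1)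
  rw [phiThree_eq, psiThree_eq]
  exact key _ _ _ _ _ _ _ _ (f_mul_fInv one_pos) (f_mul_fInv two_pos)

theorem thetaA_mul_f_two : thetaA * f 2 = psi * phiThree := by
  rw [phiThree_eq, thetaA, psi]
  ring

theorem omega_sq_mul_f_two : f 2 * omega ^ 2 = phi * psiThree ^ 2 := by
  have h2 := f_mul_fInv two_pos
  rw [psiThree_eq, omega, phi]
  linear_combination (f 1 ^ 2 * f 6 ^ 4 * fInv 2 * fInv 3 ^ 2) * h2

theorem psi_mul_fInv_cube : psi * fInv 2 ^ 3 = cubeInv * phi := by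
  have h1 := f_mul_fInv one_pos
  have h2 := f_mul_fInv two_pos
  rw [psi, cubeInv, phi]
  linear_combination (fInv 1 * fInv 2) * ((f 2 * fInv 2 + 1) * h2 - (f 1 * fInv 1 + 1) * h1)

theorem f_one_cube : f 1 ^ 3 = phi ^ 2 * psi := by
  have h1 := f_mul_fInv one_pos
  have h2 := f_mul_fInv two_pos
  rw [psi, phi]
  linear_combination (-f 1 ^ 3) * (f 1 * fInv 1 * (f 2 * fInv 2 + 1) * h2 + h1)

theorem f_one_cube_mul_cubeInv : f 1 ^ 3 * cubeInv = 1 := by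
  rw [cubeInv, ← mul_pow, f_mul_fInv one_pos, one_pow]

theorem expandThree_f_one_cube : expandThree (f 1 ^ 3) = cubeOne := by
  rw [f_one_cube, map_mul, map_pow, cubeOne]

theorem cubeOne_mul : cubeOne * expandThree cubeInv = 1 := by
  have := congrArg expandThree f_one_cube_mul_cubeInv
  rwa [map_mul, map_one, expandThree_f_one_cube] at this

/-- Expand f_1³ = φ(-q)²ψ(q) by the 3-dissections. The relation `thetaA_mul_omega` kills the q²
class and turns 1 - 4 into the coefficient -3. -/
theorem f_one_cube_dissection :
    f 1 ^ 3 = expandThree cubeZero - 3 * X * expandThree cubeOne := by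
  have h := congrArg expandThree thetaA_mul_omega
  rw [f_one_cube, phi_three]
  nth_rw 1 [psi_three]
  rw [cubeZero, cubeOne]
  simp only [map_mul, map_add, map_pow, map_ofNat, expand_X] at h ⊢
  generalize expandThree thetaA = a at *
  generalize expandThree omega = w at *
  generalize expandThree phiThree = p at *
  generalize expandThree psiThree = b at *
  linear_combination (4 * X ^ 2 * w - 4 * X * p) * h

/-- Raise f_1³ = φ²ψ to the fourth power, replace φ^8 and ψ^4 by the cubic relations, and reduce
with `thetaA_mul_omega`. -/
theorem cubeNorm_mul_cubeOne : cubeNorm * cubeOne = (f 1 ^ 3) ^ 4 := by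
  have key : ∀ {R : Type} [CommRing R] (x φ ψ p b a w : R),
      (p ^ 3 - 8 * x * w ^ 3) * p = φ ^ 4 → (a ^ 3 + x * b ^ 3) * b = ψ ^ 4 → a * w = p * b →
      ((p ^ 2 * a + 4 * x * w ^ 2 * b) ^ 3 - 27 * x * (p ^ 2 * b) ^ 3) * (p ^ 2 * b) =
        (φ ^ 2 * ψ) ^ 4 := by
    intro R _ x φ ψ p b a w h1 h2 h3
    have e1 : (φ ^ 2 * ψ) ^ 4 = ((p ^ 3 - 8 * x * w ^ 3) * p) ^ 2 * ((a ^ 3 + x * b ^ 3) * b) := by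
      rw [h1, h2]; ring
    have e2 : a ^ 2 * w ^ 2 = p ^ 2 * b ^ 2 := by rw [← mul_pow, h3, mul_pow]
    have e3 : a ^ 3 * w ^ 3 = p ^ 3 * b ^ 3 := by rw [← mul_pow, h3, mul_pow]
    rw [e1]
    linear_combination (p ^ 2 * b) * (12 * x * p ^ 4 * b * e2 +
      48 * x ^ 2 * p ^ 2 * w ^ 3 * b ^ 2 * h3 +
      (16 * x * p ^ 3 - 64 * x ^ 2 * w ^ 3) * e3)
  rw [f_one_cube]
  exact key _ _ _ _ _ _ _ phi_cubic_relation psi_cubic_relation thetaA_mul_omega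

theorem cubeNorm_inv : cubeNorm * cubeOne * cubeInv ^ 4 = 1 := by
  rw [cubeNorm_mul_cubeOne, ← mul_pow, f_one_cube_mul_cubeInv, one_pow]

/-- The denominator P - 3qR is rationalised by P² + 3qPR + 9q²R², which completes it to P³ - 27q³R³;
here P and R are taken at q³. -/
theorem cubeInv_dissection : cubeInv = expandThree (cubeOne * cubeInv ^ 4) *
    (expandThree cubeZero ^ 2 + 3 * X * expandThree cubeZero * expandThree cubeOne +
      9 * X ^ 2 * expandThree cubeOne ^ 2) := by
  have h1 := congrArg expandThree cubeNorm_inv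
  have h2 := f_one_cube_mul_cubeInv
  have h3 := f_one_cube_dissection
  have h4 : expandThree cubeNorm = expandThree cubeZero ^ 3 -
      27 * X ^ 3 * expandThree cubeOne ^ 3 := by
    rw [cubeNorm]
    simp only [map_mul, map_sub, map_pow, map_ofNat, expand_X]
  rw [mul_assoc, map_mul, h4, map_one] at h1
  generalize expandThree (cubeOne * cubeInv ^ 4) = v at *
  generalize expandThree cubeZero = P at *
  generalize expandThree cubeOne = R at *
  generalize f 1 ^ 3 = c at *
  subst h3
  linear_combination (-cubeInv) * h1 + v * (P ^ 2 + 3 * X * P * R + 9 * X ^ 2 * R ^ 2) * h2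

/-- One third of the `3n + 2` section of `f_2^2 / f_1^7`, up to a multiple of `81`. -/
noncomputable def secQuot : ℤ⟦X⟧ :=
  ((9 : ℕ) : ℤ⟦X⟧) * (thetaA * cubeZero ^ 2 * cubeOne ^ 4 * cubeInv ^ 8) +
    2 * psiThree * cubeOne ^ 2 * cubeInv ^ 4

theorem sec_three_two_base : sec 3 2 (psi * cubeInv ^ 2) = ((3 : ℕ) : ℤ⟦X⟧) * secQuot +
    ((243 : ℕ) : ℤ⟦X⟧) * (X * psiThree * cubeOne ^ 6 * cubeInv ^ 8) := by
  have h : psi * cubeInv ^ 2 =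
      expandThree ((cubeOne * cubeInv ^ 4) ^ 2 * (thetaA *
        (cubeZero ^ 4 + 54 * X * cubeZero * cubeOne ^ 3) +
          X * psiThree * (27 * cubeZero ^ 2 * cubeOne ^ 2))) +
      X * expandThree ((cubeOne * cubeInv ^ 4) ^ 2 * (thetaA *
        (6 * cubeZero ^ 3 * cubeOne + 81 * X * cubeOne ^ 4) +
          psiThree * (cubeZero ^ 4 + 54 * X * cubeZero * cubeOne ^ 3))) +
      X ^ 2 * expandThree ((cubeOne * cubeInv ^ 4) ^ 2 * (thetaA *
        (27 * cubeZero ^ 2 * cubeOne ^ 2) +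
          psiThree * (6 * cubeZero ^ 3 * cubeOne + 81 * X * cubeOne ^ 4))) := by
    nth_rw 1 [cubeInv_dissection]
    nth_rw 1 [psi_three]
    generalize cubeOne * cubeInv ^ 4 = v
    simp only [map_mul, map_add, map_pow, map_ofNat, expand_X]
    generalize expandThree thetaA = a
    generalize expandThree psiThree = b
    generalize expandThree v = v
    generalize expandThree cubeZero = P
    generalize expandThree cubeOne = R
    ring
  have h1 := cubeNorm_inv
  rw [cubeNorm] at h1
  rw [h, sec_three (by norm_num), secQuot]
  simp only [OfNat.ofNat_ne_zero, OfNat.ofNat_ne_one, if_false]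
  push_cast
  -- In the term 6P³R, P³ is replaced by the norm plus 27XR³; the resulting 162 joins 81 to make
  -- 243.
  linear_combination (6 * psiThree * cubeOne ^ 2 * cubeInv ^ 4) * h1

/-- One ninth of the `3n + 2` section of `secQuot`. -/
noncomputable def secQuotTwo : ℤ⟦X⟧ :=
  sec 3 2 (thetaA * cubeZero ^ 2 * cubeOne ^ 4 * cubeInv ^ 8) +
    2 * (psi * (f 1 ^ 3) ^ 2 * (cubeOne * cubeInv ^ 4) ^ 4 *
      (10 * cubeZero ^ 6 * cubeOne ^ 2 + 432 * X * cubeZero ^ 3 * cubeOne ^ 5 +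
        729 * X ^ 2 * cubeOne ^ 8))

/-- In (P² + 3qPR + 9q²R²)^4 every coefficient of the class q² is divisible by 9, beginning with 90.
-/
theorem sec_secQuot : sec 3 2 secQuot = ((9 : ℕ) : ℤ⟦X⟧) * secQuotTwo := by
  have h : 2 * psiThree * cubeOne ^ 2 * cubeInv ^ 4 =
      expandThree (2 * (psi * (f 1 ^ 3) ^ 2 * (cubeOne * cubeInv ^ 4) ^ 4 *
        (cubeZero ^ 8 + 432 * X * cubeZero ^ 5 * cubeOne ^ 3 +
          7290 * X ^ 2 * cubeZero ^ 2 * cubeOne ^ 6))) +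
      X * expandThree (2 * (psi * (f 1 ^ 3) ^ 2 * (cubeOne * cubeInv ^ 4) ^ 4 *
        (12 * cubeZero ^ 7 * cubeOne + 1539 * X * cubeZero ^ 4 * cubeOne ^ 4 +
          8748 * X ^ 2 * cubeZero * cubeOne ^ 7))) +
      X ^ 2 * expandThree (9 * (2 * (psi * (f 1 ^ 3) ^ 2 * (cubeOne * cubeInv ^ 4) ^ 4 *
        (10 * cubeZero ^ 6 * cubeOne ^ 2 + 432 * X * cubeZero ^ 3 * cubeOne ^ 5 +
          729 * X ^ 2 * cubeOne ^ 8)))) := by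
    have e : cubeOne ^ 2 * cubeInv ^ 4 = expandThree (f 1 ^ 3) ^ 2 *
        (expandThree (cubeOne * cubeInv ^ 4) *
          (expandThree cubeZero ^ 2 + 3 * X * expandThree cubeZero * expandThree cubeOne +
          9 * X ^ 2 * expandThree cubeOne ^ 2)) ^ 4 := by
      rw [← cubeInv_dissection, expandThree_f_one_cube]
    rw [mul_assoc (2 * psiThree), e]
    generalize cubeOne * cubeInv ^ 4 = v
    generalize f 1 ^ 3 = c
    simp only [map_mul, map_add, map_pow, map_ofNat, expand_X]
    generalize expandThree c = c
    generalize expandThree v = v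
    generalize expandThree cubeZero = P
    generalize expandThree cubeOne = R
    ring
  rw [secQuot, map_add, sec_natCast_mul, h, sec_three (by norm_num), secQuotTwo]
  simp only [OfNat.ofNat_ne_zero, OfNat.ofNat_ne_one, if_false]
  push_cast
  ring

theorem f_two_mul_cubeZero :
    f 2 * cubeZero = phiThree ^ 3 * psi + 4 * X * psiThree ^ 3 * phi := by
  rw [cubeZero]
  linear_combination phiThree ^ 2 * thetaA_mul_f_two + 4 * X * psiThree * omega_sq_mul_f_two

theorem sec_phi_mul_sq : sec 3 2 (phi * (phiThree ^ 3 * psi + 4 * X * psiThree ^ 3 * phi) ^ 2) =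
    -3 * phiThree * psiThree ^ 2 * phi ^ 6 - 24 * phi ^ 3 * psi ^ 3 * phiThree ^ 2 * psiThree +
      16 * psi ^ 6 * (phiThree ^ 3 - 8 * X * omega ^ 3) := by
  have h : phi * (phiThree ^ 3 * psi + 4 * X * psiThree ^ 3 * phi) ^ 2 =
      expandThree (phi ^ 6 * (phiThree * thetaA ^ 2 - 2 * X * omega * psiThree ^ 2) +
        8 * phi ^ 3 * psi ^ 3 * X * (4 * omega ^ 2 * thetaA - 4 * phiThree * omega * psiThree) +
        16 * psi ^ 6 * X * (-6 * phiThree ^ 2 * omega)) +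
      X * expandThree (phi ^ 6 * (2 * phiThree * thetaA * psiThree - 2 * omega * thetaA ^ 2) +
        8 * phi ^ 3 * psi ^ 3 * (phiThree ^ 2 * thetaA + 4 * X * omega ^ 2 * psiThree) +
        16 * psi ^ 6 * X * (12 * phiThree * omega ^ 2)) +
      X ^ 2 * expandThree (phi ^ 6 * (phiThree * psiThree ^ 2 - 4 * omega * thetaA * psiThree) +
        8 * phi ^ 3 * psi ^ 3 * (phiThree ^ 2 * psiThree - 4 * phiThree * omega * thetaA) +
        16 * psi ^ 6 * (phiThree ^ 3 - 8 * X * omega ^ 3)) := by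
    have key : ∀ {R : Type} [CommRing R] (t x y p b p' b' a w : R), x = p' - 2 * t * w →
        y = a + t * b' → x * (p ^ 3 * y + 4 * t * b ^ 3 * x) ^ 2 =
        p ^ 6 * (p' * a ^ 2 - 2 * t ^ 3 * w * b' ^ 2) +
          8 * p ^ 3 * b ^ 3 * t ^ 3 * (4 * w ^ 2 * a - 4 * p' * w * b') +
          16 * b ^ 6 * t ^ 3 * (-6 * p' ^ 2 * w) +
        t * (p ^ 6 * (2 * p' * a * b' - 2 * w * a ^ 2) +
          8 * p ^ 3 * b ^ 3 * (p' ^ 2 * a + 4 * t ^ 3 * w ^ 2 * b') +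
          16 * b ^ 6 * t ^ 3 * (12 * p' * w ^ 2)) +
        t ^ 2 * (p ^ 6 * (p' * b' ^ 2 - 4 * w * a * b') +
          8 * p ^ 3 * b ^ 3 * (p' ^ 2 * b' - 4 * p' * w * a) +
          16 * b ^ 6 * (p' ^ 3 - 8 * t ^ 3 * w ^ 3)) := by
      intro R _ t x y p b p' b' a w h1 h2
      rw [h1, h2]
      ring
    simp only [map_mul, map_add, map_sub, map_pow, map_ofNat, map_neg, expand_X]
    exact key _ _ _ _ _ _ _ _ _ phi_three psi_three
  have h3 := thetaA_mul_omega
  rw [h, sec_three (by norm_num)]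
  simp only [OfNat.ofNat_ne_zero, OfNat.ofNat_ne_one, if_false]
  linear_combination (-4 * psiThree * phi ^ 6 - 32 * phi ^ 3 * psi ^ 3 * phiThree) * h3

theorem red_nine_cubeInv_cube : red 9 (cubeInv ^ 3) = red 9 (expandThree cubeInv) := by
  have := red_pow_prime_pow Nat.prime_three (fInv 1) 1 (n := 9) (m := 3) rfl rfl
  rw [cubeInv, ← pow_mul, map_pow expandThree]
  exact this

theorem red_nine_cubeOne : red 9 ((phi ^ 2 * psi) ^ 3) = red 9 cubeOne := by
  have := red_pow_prime_pow Nat.prime_three (f 1) 1 (n := 9) (m := 3) rfl rfl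
  rw [← expandThree_f_one_cube, ← f_one_cube, ← pow_mul, map_pow expandThree]
  exact this

theorem red_nine_three_mul_phi_cube :
    red 9 (((3 : ℕ) : ℤ⟦X⟧) * phi ^ 3) = red 9 (((3 : ℕ) : ℤ⟦X⟧) * phiThree) :=
  red_natCast_mul (n := 3) 3 (red_pow_prime Nat.prime_three phi)

theorem phiThree_mul_inv : phiThree * expandThree phiInv = 1 := by
  rw [phiThree, ← map_mul, phi_mul_phiInv, map_one]

/-- Trading denominators for c = f_1^{-3} with c³ ≡ c(q³) mod 9 leaves the section in
`sec_phi_mul_sq`. Its terms with -3 and -24 combine to -27 ≡ 0, and the third reduces by the cubic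
relation for φ. -/
theorem red_nine_secQuotTwo : red 9 secQuotTwo =
    red 9 (16 * phi * psi ^ 4 * expandThree (phi * psi) +
      2 * psi * expandThree (phi ^ 4 * psi ^ 2)) := by
  have k1 := red_nine_cubeInv_cube
  have k2 := red_nine_cubeOne
  have k3 := red_nine_three_mul_phi_cube
  have k4 := congrArg (red 9) phiThree_mul_inv
  have k5 := congrArg (red 9) phi_cubic_relation
  have h9 := natCast_red 9
  have first : red 9 (thetaA * cubeZero ^ 2 * cubeOne ^ 4 * cubeInv ^ 8) =
      red 9 (phi * (phiThree ^ 3 * psi + 4 * X * psiThree ^ 3 * phi) ^ 2 *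
        expandThree (phi ^ 3 * psi)) := by
    have e : thetaA * cubeZero ^ 2 * cubeOne ^ 4 * cubeInv ^ 8 =
        phi * (phiThree ^ 3 * psi + 4 * X * psiThree ^ 3 * phi) ^ 2 *
          (phiThree * cubeOne ^ 4 * (cubeInv ^ 3) ^ 3) := by
      rw [← f_two_mul_cubeZero]
      have e1 := thetaA_mul_f_two
      have e2 := psi_mul_fInv_cube
      have e3 := f_mul_fInv two_pos
      have e4 : (f 2 * fInv 2) ^ 3 = 1 := by rw [e3, one_pow]
      linear_combination (cubeZero ^ 2 * cubeOne ^ 4 * cubeInv ^ 8) *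
        (-thetaA * e4 + f 2 ^ 2 * fInv 2 ^ 3 * e1 + f 2 ^ 2 * phiThree * e2)
    have e5 : phiThree * cubeOne ^ 4 * (expandThree cubeInv) ^ 3 = expandThree (phi ^ 3 * psi) := by
      have e6 : (cubeOne * expandThree cubeInv) ^ 3 = 1 := by rw [cubeOne_mul, one_pow]
      rw [map_mul, map_pow]
      have e7 : phiThree * cubeOne = phiThree ^ 3 * psiThree := by rw [cubeOne]; ring
      linear_combination phiThree * cubeOne * e6 + e7
    rw [e, ← e5]
    simp only [map_mul (red 9), map_pow (red 9)] at k1 ⊢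
    rw [k1]
  have second : red 9 (psi * (f 1 ^ 3) ^ 2 * (cubeOne * cubeInv ^ 4) ^ 4 *
      (10 * cubeZero ^ 6 * cubeOne ^ 2 + 432 * X * cubeZero ^ 3 * cubeOne ^ 5 +
        729 * X ^ 2 * cubeOne ^ 8)) = red 9 (psi * cubeOne ^ 2) := by
    have e1 : red 9 (10 * cubeZero ^ 6 * cubeOne ^ 2 + 432 * X * cubeZero ^ 3 * cubeOne ^ 5 +
        729 * X ^ 2 * cubeOne ^ 8) = red 9 (cubeNorm ^ 2 * cubeOne ^ 2) := by
      rw [red_eq_red, cubeNorm]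
      refine ⟨cubeZero ^ 6 * cubeOne ^ 2 + 54 * X * cubeZero ^ 3 * cubeOne ^ 5, ?_⟩
      push_cast
      ring
    have e2 : psi * (f 1 ^ 3) ^ 2 * (cubeOne * cubeInv ^ 4) ^ 4 * (cubeNorm ^ 2 * cubeOne ^ 2) =
        psi * cubeOne ^ 4 * (cubeInv ^ 3) ^ 2 := by
      have e3 : (cubeNorm * cubeOne * cubeInv ^ 4) ^ 2 = 1 := by rw [cubeNorm_inv, one_pow]
      have e4 : (f 1 ^ 3 * cubeInv) ^ 2 = 1 := by rw [f_one_cube_mul_cubeInv, one_pow]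
      linear_combination (psi * cubeOne ^ 4 * cubeInv ^ 6) * ((f 1 ^ 3 * cubeInv) ^ 2 * e3 + e4)
    have e5 : psi * cubeOne ^ 4 * (expandThree cubeInv) ^ 2 = psi * cubeOne ^ 2 := by
      have e6 : (cubeOne * expandThree cubeInv) ^ 2 = 1 := by rw [cubeOne_mul, one_pow]
      linear_combination psi * cubeOne ^ 2 * e6
    rw [map_mul, e1, ← map_mul, e2, ← e5]
    simp only [map_mul (red 9), map_pow (red 9)] at k1 ⊢
    rw [k1]
  rw [secQuotTwo, map_add, map_mul _ 2, second, red_sec first, sec_mul_expand (by norm_num),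
    sec_phi_mul_sq, cubeOne]
  rw [cubeOne] at k2
  simp only [map_mul, map_add, map_sub, map_pow, map_ofNat, map_neg, map_natCast, map_one]
    at k2 k3 k4 k5 h9 ⊢
  generalize red 9 phiThree = p at *
  generalize red 9 psiThree = b at *
  generalize red 9 (expandThree phiInv) = p' at *
  generalize red 9 phi = x at *
  generalize red 9 psi = y at *
  generalize red 9 X = t at *
  generalize red 9 omega = w at *
  push_cast at k3 h9
  linear_combination (-p * b ^ 2 * y * (x ^ 6 + p * x ^ 3 + p ^ 2)) * k3 +
    (-24 * p ^ 2 * b * y) * k2 - 3 * p ^ 4 * b ^ 2 * y * h9 +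
    16 * y ^ 7 * x ^ 3 * p' * k5 + 16 * x * y ^ 4 * p' * k2 +
    (16 * x * y ^ 4 * p * b - 16 * y ^ 7 * x ^ 3 * (p ^ 3 - 8 * t * w ^ 3)) * k4

/-- The inverse of `psi`. -/
noncomputable def psiInv : ℤ⟦X⟧ := f 1 * fInv 2 ^ 2

theorem psi_mul_psiInv : psi * psiInv = 1 := by
  have h1 := f_mul_fInv one_pos
  have h2 := f_mul_fInv two_pos
  rw [psi, psiInv]
  linear_combination (f 2 * fInv 2) ^ 2 * h1 + (f 2 * fInv 2 + 1) * h2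

theorem psiThree_mul_inv : psiThree * expandThree psiInv = 1 := by
  rw [psiThree, ← map_mul, psi_mul_psiInv, map_one]

/-- Since (f_2/f_1)³ = ψ/φ, its cube is ≡ ψ(q³)/φ(-q³) mod 9. -/
theorem red_nine_phiThree_mul_psi_cube :
    red 9 (phiThree * psi ^ 3) = red 9 (psiThree * phi ^ 3) := by
  have h := red_pow_prime_pow Nat.prime_three (f 2 * fInv 1) 1 (n := 9) (m := 3) rfl rfl
  have e : (f 2 * fInv 1) ^ 3 = psi * phiInv := by rw [psi, phiInv]; ring
  have e1 : (f 2 * fInv 1) ^ 9 = (psi * phiInv) ^ 3 := by rw [← e]; ring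
  rw [← map_pow (expand 3 _), e, e1, map_mul (expand 3 _)] at h
  have h2 := congrArg (red 9) phi_mul_phiInv
  have h3 := congrArg (red 9) phiThree_mul_inv
  change _ = red 9 (psiThree * expandThree phiInv) at h
  simp only [map_mul (red 9), map_pow (red 9), map_one] at h h2 h3 ⊢
  have h4 : (red 9 phi * red 9 phiInv) ^ 3 = 1 := by rw [h2, one_pow]
  linear_combination red 9 phiThree * red 9 phi ^ 3 * h - red 9 phiThree * red 9 psi ^ 3 * h4 +
    red 9 psiThree * red 9 phi ^ 3 * h3

theorem sec_phi_mul_psi_pow_four : sec 3 0 (phi * psi ^ 4) =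
    phiThree * thetaA * (thetaA ^ 3 - 8 * X * psiThree ^ 3) := by
  have h : phi * psi ^ 4 =
      expandThree (phiThree * thetaA ^ 4 + X * (4 * phiThree * thetaA * psiThree ^ 3 -
        12 * omega * thetaA ^ 2 * psiThree ^ 2)) +
      X * expandThree (4 * phiThree * thetaA ^ 3 * psiThree - 2 * omega * thetaA ^ 4 +
        X * (phiThree * psiThree ^ 4 - 8 * omega * thetaA * psiThree ^ 3)) +
      X ^ 2 * expandThree (6 * phiThree * thetaA ^ 2 * psiThree ^ 2 -
        8 * omega * thetaA ^ 3 * psiThree + X * (-2 * omega * psiThree ^ 4)) := by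
    have h1 := phi_three
    have h2 := psi_three
    simp only [map_mul, map_add, map_sub, map_pow, map_ofNat, map_neg, expand_X]
    generalize expandThree phiThree = p9 at *
    generalize expandThree psiThree = b9 at *
    generalize expandThree thetaA = a at *
    generalize expandThree omega = w at *
    rw [h1, h2]
    ring
  have h3 := thetaA_mul_omega
  rw [h, sec_three (by norm_num), if_pos rfl]
  linear_combination (-12 * X * thetaA * psiThree ^ 2) * h3

theorem sec_psi_zero : sec 3 0 psi = thetaA := by
  have h : psi = expandThree thetaA + X * expandThree psiThree + X ^ 2 * expandThree 0 := by
    rw [map_zero, mul_zero, add_zero]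
    exact psi_three
  rw [h, sec_three (by norm_num), if_pos rfl]

theorem sec_phi_zero : sec 3 0 phi = phiThree := by
  have h : phi = expandThree phiThree + X * expandThree (-2 * omega) + X ^ 2 * expandThree 0 := by
    rw [map_zero, mul_zero, add_zero, map_mul, map_neg, map_ofNat]
    linear_combination phi_three
  rw [h, sec_three (by norm_num), if_pos rfl]

theorem red_nine_sec_secQuotTwo : red 9 (sec 3 0 secQuotTwo) = 0 := by
  have h := red_sec red_nine_secQuotTwo 3 0
  have e : 16 * phi * psi ^ 4 * expandThree (phi * psi) +
      2 * psi * expandThree (phi ^ 4 * psi ^ 2) =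
      ((16 : ℕ) : ℤ⟦X⟧) * (phi * psi ^ 4 * expandThree (phi * psi)) +
      ((2 : ℕ) : ℤ⟦X⟧) * (psi * expandThree (phi ^ 4 * psi ^ 2)) := by
    push_cast
    ring
  rw [e, map_add (sec 3 0), sec_natCast_mul, sec_natCast_mul, sec_mul_expand (by norm_num),
    sec_mul_expand (by norm_num), sec_phi_mul_psi_pow_four, sec_psi_zero] at h
  rw [h]
  have k1 := congrArg (red 9) psi_cubic_relation
  have k2 := red_nine_phiThree_mul_psi_cube
  have k3 := congrArg (red 9) psiThree_mul_inv
  have h9 := natCast_red 9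
  change red 9 ((thetaA ^ 3 + X * psiThree ^ 3) * psiThree) = _ at k1
  simp only [map_mul, map_add, map_sub, map_pow, map_ofNat, map_natCast, map_one]
    at k1 k2 k3 h9 ⊢
  generalize red 9 phiThree = p at *
  generalize red 9 psiThree = b at *
  generalize red 9 (expandThree psiInv) = b' at *
  generalize red 9 phi = x at *
  generalize red 9 psi = y at *
  generalize red 9 X = t at *
  generalize red 9 thetaA = a at *
  push_cast at h9 ⊢
  -- As -8 ≡ 1 mod 9, the factor b = ψ(q³) completes the cubic relation for ψ. Both summands become
  -- multiples of a x^4 y² b, with total coefficient 16 + 2 = 18.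
  have key : (16 * (p * a * (a ^ 3 - 8 * t * b ^ 3) * (x * y)) + 2 * (a * (x ^ 4 * y ^ 2))) * b =
      0 := by
    linear_combination (16 * p * a * x * y) * k1 + 16 * a * x * y ^ 2 * k2 +
      (2 * a * x ^ 4 * y ^ 2 * b - 16 * p * a * x * y * t * b ^ 4) * h9
  linear_combination b' * key -
    (16 * (p * a * (a ^ 3 - 8 * t * b ^ 3) * (x * y)) + 2 * (a * (x ^ 4 * y ^ 2))) * k3

/-- `f_2 / f_1^3`. -/
noncomputable def fQuot : ℤ⟦X⟧ := f 2 * fInv 1 ^ 3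

theorem genFun_add_two (k : ℕ) : genFun (k + 2) = psi * cubeInv ^ 2 * fQuot ^ k := by
  rw [genFun_eq, psi, cubeInv, fQuot]
  ring

theorem red_mul_pow_expandThree {n : ℕ} {A B : ℤ⟦X⟧} (h : red n A = red n (expandThree B))
    (F : ℤ⟦X⟧) (k : ℕ) : red n (F * A ^ k) = red n (F * expandThree (B ^ k)) := by
  rw [map_mul (red n), map_mul (red n), map_pow (red n) A, h, map_pow expandThree,
    map_pow (red n)]

theorem red_sec_genFun_add_two {m n l : ℕ}
    (h : red n (fQuot ^ m) = red n (expandThree (fQuot ^ l))) (j : ℕ) :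
    red n (sec 3 2 (genFun (m * j + 2))) =
      red n (sec 3 2 (psi * cubeInv ^ 2) * fQuot ^ (l * j)) := by
  have h1 : red n (genFun (m * j + 2)) =
      red n (psi * cubeInv ^ 2 * expandThree (fQuot ^ (l * j))) := by
    rw [genFun_add_two, pow_mul, pow_mul]
    exact red_mul_pow_expandThree h _ j
  rw [red_sec h1, sec_mul_expand (by norm_num)]

theorem red_fQuot_pow (k : ℕ) {m n : ℕ} (hn : 3 ^ (k + 1) = n) (hm : 3 ^ k = m) :
    red n (fQuot ^ n) = red n (expandThree (fQuot ^ m)) := by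
  rw [map_pow expandThree]
  exact red_pow_prime_pow Nat.prime_three fQuot k hn hm

theorem red_sec_secQuot_mul {m n l : ℕ}
    (h : red n (fQuot ^ m) = red n (expandThree (fQuot ^ l))) (j : ℕ) :
    red n (sec 3 2 (secQuot * fQuot ^ (m * j))) =
      red n (((9 : ℕ) : ℤ⟦X⟧) * (secQuotTwo * fQuot ^ (l * j))) := by
  have h1 : red n (secQuot * fQuot ^ (m * j)) =
      red n (secQuot * expandThree (fQuot ^ (l * j))) := by
    rw [pow_mul, pow_mul]
    exact red_mul_pow_expandThree h _ j
  rw [red_sec h1, sec_mul_expand (by norm_num), sec_secQuot, mul_assoc]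

theorem red_base_mul {n : ℕ} (hn : n ∣ 243) (F : ℤ⟦X⟧) :
    red n (sec 3 2 (psi * cubeInv ^ 2) * F) = red n (((3 : ℕ) : ℤ⟦X⟧) * (secQuot * F)) := by
  refine red_of_dvd (n := 243) ?_ hn
  rw [red_eq_red, sec_three_two_base]
  exact ⟨X * psiThree * cubeOne ^ 6 * cubeInv ^ 8 * F, by ring⟩

theorem red_twentySeven_sec (j : ℕ) :
    red 27 (sec 3 2 (sec 3 2 (genFun (27 * j + 2)))) = 0 := by
  have h1 := red_sec_genFun_add_two (red_fQuot_pow 2 (n := 27) (m := 9) rfl rfl) j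
  rw [red_base_mul (by norm_num)] at h1
  have h2 := red_sec_secQuot_mul (red_fQuot_pow 1 (n := 9) (m := 3) rfl rfl) j
  have h3 : red 9 (sec 3 2 (secQuot * fQuot ^ (9 * j))) = red 9 0 := by
    rw [h2, map_mul, map_natCast, natCast_red, zero_mul, map_zero]
  rw [red_sec h1, sec_natCast_mul]
  have h4 := red_natCast_mul 3 h3
  rw [mul_zero, map_zero] at h4
  exact h4

theorem red_twoHundredFortyThree_sec (j : ℕ) :
    red 243 (sec 3 0 (sec 3 2 (sec 3 2 (genFun (243 * j + 2))))) = 0 := by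
  have h1 := red_sec_genFun_add_two (red_fQuot_pow 4 (n := 243) (m := 81) rfl rfl) j
  rw [red_base_mul dvd_rfl] at h1
  have h2 := red_sec_secQuot_mul (red_fQuot_pow 3 (n := 81) (m := 27) rfl rfl) j
  have h3 : red 9 (sec 3 0 (secQuotTwo * fQuot ^ (27 * j))) = red 9 0 := by
    have h := red_fQuot_pow 1 (n := 9) (m := 3) rfl rfl
    have e : red 9 (secQuotTwo * fQuot ^ (27 * j)) =
        red 9 (secQuotTwo * expandThree (fQuot ^ (9 * j))) := by
      rw [show fQuot ^ (27 * j) = (fQuot ^ 9) ^ (3 * j) by ring,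
        show fQuot ^ (9 * j) = (fQuot ^ 3) ^ (3 * j) by ring]
      exact red_mul_pow_expandThree h _ _
    rw [red_sec e, sec_mul_expand (by norm_num), map_mul, red_nine_sec_secQuotTwo, zero_mul,
      map_zero]
  have h4 : red 81 (sec 3 0 (sec 3 2 (secQuot * fQuot ^ (81 * j)))) = red 81 0 := by
    rw [red_sec h2, sec_natCast_mul]
    have := red_natCast_mul 9 h3
    rw [mul_zero] at this
    exact this
  rw [red_sec (red_sec h1 3 2), sec_natCast_mul, sec_natCast_mul]
  have h5 := red_natCast_mul 3 h4
  rw [mul_zero, map_zero] at h5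
  exact h5

/-- With q² for q, f_1³ = P(q³) - 3q f_9³ has its second term in class 2. Class 1 would need that
term twice, which costs a factor 9. -/
theorem f_two_cube_pow_sections (k : ℕ) : ∃ U V : ℤ⟦X⟧, red 9 ((f 2 ^ 3) ^ k) =
    red 9 (expandThree U + X * expandThree 0 + X ^ 2 * expandThree (3 * V)) := by
  have hcomm : ∀ F : ℤ⟦X⟧, expand 2 (by norm_num) (expandThree F) =
      expandThree (expand 2 (by norm_num) F) := fun F =>
    (expand_mul 2 (by norm_num) 3 (by norm_num) F).symm.trans
      (expand_mul 3 (by norm_num) 2 (by norm_num) F)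
  have hf : f 2 ^ 3 = expandThree (expand 2 (by norm_num) cubeZero) -
      3 * X ^ 2 * expandThree (expand 2 (by norm_num) cubeOne) := by
    have := congrArg (expand 2 (by norm_num)) f_one_cube_dissection
    rwa [map_pow, ← f_two, map_sub, map_mul, map_mul, hcomm, hcomm, expand_X, map_ofNat] at this
  induction k with
  | zero => exact ⟨1, 0, by simp⟩
  | succ k ih =>
    obtain ⟨U, V, h⟩ := ih
    rw [pow_succ, map_mul, h, ← map_mul, hf]
    generalize expand 2 _ cubeZero = A
    generalize expand 2 _ cubeOne = B
    refine ⟨U * A, V * A - U * B, ?_⟩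
    rw [red_eq_red]
    refine ⟨-X ^ 4 * expandThree V * expandThree B, ?_⟩
    simp only [map_mul, map_sub, map_zero, map_ofNat]
    push_cast
    ring

/-- The first section is φ(-q³)(f_2³/f_1^9)^{j+1} mod 9. Since f_1^{-9} ≡ f_3^{-3}, only powers of
f_2³ matter, and these have no class 1. -/
theorem red_nine_sec (j : ℕ) : red 9 (sec 3 1 (sec 3 0 (genFun (9 * j + 8)))) = 0 := by
  have e : genFun (9 * j + 8) = phi * (fQuot ^ 9) ^ (j + 1) := by
    have h1 := f_mul_fInv one_pos
    have h2 := f_mul_fInv two_pos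
    have e1 : f 1 ^ 2 * fInv 1 ^ 2 = 1 := by rw [← mul_pow, h1, one_pow]
    rw [genFun_eq, phi, fQuot]
    linear_combination (-f 2 ^ (9 * j + 8) * fInv 1 ^ (3 * (9 * j + 8) + 1)) *
      (f 1 ^ 2 * fInv 1 ^ 2 * h2 + e1)
  have h := red_fQuot_pow 1 (n := 9) (m := 3) rfl rfl
  have h1 : red 9 (genFun (9 * j + 8)) = red 9 (phi * expandThree ((fQuot ^ 3) ^ (j + 1))) := by
    rw [e]
    exact red_mul_pow_expandThree h _ _
  have h2 := red_sec h1 3 0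
  rw [sec_mul_expand (by norm_num), sec_phi_zero] at h2
  have h3 : red 9 (fInv 1 ^ 9) = red 9 (expandThree (fInv 1 ^ 3)) := by
    rw [map_pow expandThree]
    exact red_pow_prime_pow Nat.prime_three (fInv 1) 1 rfl rfl
  have h4 : red 9 (phiThree * (fQuot ^ 3) ^ (j + 1)) =
      red 9 ((f 2 ^ 3) ^ (j + 1) * expandThree (phi * (fInv 1 ^ 3) ^ (j + 1))) := by
    rw [show phiThree * (fQuot ^ 3) ^ (j + 1) =
      phiThree * (f 2 ^ 3) ^ (j + 1) * (fInv 1 ^ 9) ^ (j + 1) by rw [fQuot]; ring,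
      red_mul_pow_expandThree h3, map_mul expandThree, mul_comm phiThree, mul_assoc]
  obtain ⟨U, V, h5⟩ := f_two_cube_pow_sections (j + 1)
  rw [red_sec (h2.trans h4), sec_mul_expand (by norm_num), map_mul, red_sec h5,
    sec_three (by norm_num)]
  simp

end PowersOfThree

end ElongatedDiamond

/-! ### The ten congruences. -/

theorem mainTheorem2 (n j : ℕ) :
    ElongatedDiamond.d (4 * j + 3) (4 * n + 2) ≡ 0 [ZMOD 2] ∧
    ElongatedDiamond.d (4 * j + 3) (4 * n + 3) ≡ 0 [ZMOD 4] ∧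
    ElongatedDiamond.d (8 * j + 7) (4 * n + 2) ≡ 0 [ZMOD 4] ∧
    ElongatedDiamond.d (8 * j + 7) (8 * n + 5) ≡ 0 [ZMOD 4] ∧
    ElongatedDiamond.d (16 * j + 7) (16 * n + 9) ≡ 0 [ZMOD 4] ∧
    ElongatedDiamond.d (8 * j + 7) (4 * n + 3) ≡ 0 [ZMOD 8] ∧
    ElongatedDiamond.d (32 * j + 7) (8 * n + 4) ≡ 0 [ZMOD 8] ∧
    ElongatedDiamond.d (9 * j + 8) (9 * n + 3) ≡ 0 [ZMOD 9] ∧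
    ElongatedDiamond.d (27 * j + 2) (9 * n + 8) ≡ 0 [ZMOD 27] ∧
    ElongatedDiamond.d (243 * j + 2) (27 * n + 8) ≡ 0 [ZMOD 243] := by
  open ElongatedDiamond in
  simp only [Int.modEq_zero_iff_dvd, d]
  have h1 := dvd_coeff_of_red_eq_zero (red_two_sec_four_two j) n
  have h2 := dvd_coeff_of_red_eq_zero (red_four_sec_four_three j) n
  have h3 := dvd_coeff_of_red_eq_zero (red_four_sec_four_two j) n
  have h4 := dvd_coeff_of_red_eq_zero (red_four_sec_two_one j) n
  have h5 := dvd_coeff_of_red_eq_zero (red_four_sec_four_two_sec j) n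
  have h6 := dvd_coeff_of_red_eq_zero (red_eight_sec_four_three j) n
  have h7 := dvd_coeff_of_red_eq_zero (red_eight_sec_two_one j) n
  have h8 := dvd_coeff_of_red_eq_zero (red_nine_sec j) n
  have h9 := dvd_coeff_of_red_eq_zero (red_twentySeven_sec j) n
  have h10 := dvd_coeff_of_red_eq_zero (red_twoHundredFortyThree_sec j) n
  -- Nested sections compose affinely, the outermost index being substituted into the inner ones.
  simp only [coeff_sec] at h1 h2 h3 h4 h5 h6 h7 h8 h9 h10
  rw [show 4 * (2 * n + 1) + 1 = 8 * n + 5 by ring] at h4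
  rw [show 4 * (4 * n + 2) + 1 = 16 * n + 9 by ring] at h5
  rw [show 4 * (2 * n + 1) + 0 = 8 * n + 4 by ring] at h7
  rw [show 3 * (3 * n + 1) + 0 = 9 * n + 3 by ring] at h8
  rw [show 3 * (3 * n + 2) + 2 = 9 * n + 8 by ring] at h9
  rw [show 3 * (3 * (3 * n + 0) + 2) + 2 = 27 * n + 8 by ring] at h10
  exact ⟨h1, h2, h3, h4, h5, h6, h7, h8, h9, h10⟩
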